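/- **Model.** $N$ renewal systems operate in slots $t=0,1,2,\dots$. The timeline of system $n$ is divided into back-to-back frames $\mathcal T^n_k=\{t^n_k,\dots,t^n_{k+1}-1\}$, $k\ge 0$, with $t^n_0=0$ and durations $T^n_k=t^n_{k+1}-t^n_k\ge 1$. At slot $t^n_k$ system $n$ chooses a (possibly random, possibly history-dependent) action $\alpha^n_k\in\mathcal A^n$. In each slot $t$ it incurs a penalty $y^n[t]\in\mathbb R$ and metrics $\mathbf z^n[t]\in\mathbb R^L$. There is also an external i.i.d. process $\mathbf d[t]\in\mathbb R^L$, with $\mathbf d[t]$ independent of the history before slot $t$, and $d_l=\mathbb E[d_l[t]]$. *Renewal property:* given $\alpha^n_k=a$, the $k$-th frame $(T^n_k,(y^n[t],\mathbf z^n[t])_{t\in\mathcal T^n_k})$ is independent of the history of all systems before slot $t^n_k$ and has a distribution that depends only on $n$ and $a$. Write $\widehat y^n(a),\widehat{\mathbf z}^n(a),\widehat T^n(a)$ for the expectations of $\sum_{t\in\mathcal T^n_k}y^n[t]$, $\sum_{t\in\mathcal T^n_k}\mathbf z^n[t]$, $T^n_k$ given $\alpha^n_k=a$. Let $\mathcal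 S^n$ be the convex hull of $\{(\widehat y^n(a),\widehat{\mathbf z}^n(a),\widehat T^n(a)):a\in\mathcal A^n\}$ and $\mathcal P^n=\{(y/T,\mathbf z/T):(y,\mathbf z,T)\in\mathcal S^n\}$. **Problem.** Minimize $\limsup_{T\to\infty}\frac1T\sum_{t=0}^{T-1}\sum_{n=1}^N\mathbb E[y^n[t]]$ over all decision sequences, subject to $\limsup_{T\to\infty}\frac1T\sum_{t=0}^{T-1}\sum_{n=1}^N\mathbb E[z^n_l[t]]\le d_l$ for $l=1,\dots,L$. Its infimum is denoted $f_*$. **Assumptions.** (1) The problem is feasible. (2) $|y^n[t]|\le y_{\max}$, $|z^n_l[t]|\le z_{\max}$, $|d_l[t]|\le d_{\max}$ almost surely, and there is $B\ge1$ such that $\mathbb E[(T^n_k-s)^2\mid\alpha^n_k=a,\,T^n_k\ge s]\le B$ for all $n$, all $a\in\mathcal A^n$ and all $s\in\mathbb N$ with $\Pr(T^n_k\ge s\mid\alpha^n_k=a)>0$. (3) For each $n$ the set $\{(\widehat y^n(a)/\widehat T^n(a),\widehat{\mathbf z}^n(a)/\widehat T^n(a)):a\in\mathcal A^n\}$ is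 compact. (4) (Non-vertical separating hyperplane / Lagrange multipliers.) The constants $\gamma_1,\dots,\gamma_L\ge0$ satisfy $$\sum_{n=1}^N\overline f^n+\sum_{l=1}^L\gamma_l\sum_{n=1}^N\overline g^n_l\ \ge\ f_*+\sum_{l=1}^L\gamma_l d_l\qquad\text{whenever }(\overline f^n,\overline{\mathbf g}^n)\in\mathcal P^n\text{ for all }n.$$ **Algorithm** (parameter $V>0$). Put $Q_l[0]=0$ and $Q_l[t+1]=\max\{Q_l[t]+\sum_{n=1}^N z^n_l[t]-d_l[t],\,0\}$. At the start of its $k$-th frame, system $n$ observes $\mathbf Q[t^n_k]$ and takes an action $\alpha^n_k$ minimizing over $a\in\mathcal A^n$ the ratio $$\frac{\mathbb E\big[\sum_{t\in\mathcal T^n_k}\big(Vy^n[t]+\langle \mathbf Q[t^n_k],\mathbf z^n[t]\rangle\big)\,\big|\,\alpha^n_k=a,\mathbf Q[t^n_k]\big]}{\mathbb E\big[T^n_k\,\big|\,\alpha^n_k=a,\mathbf Q[t^n_k]\big]}.$$ **Theorem.** There is a constant $C$, depending only on $N,L,y_{\max},z_{\max},d_{\max},B$ and $\gamma_1,\dots,\gamma_L$,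 such that under assumptions (1)–(4), for every $\varepsilon\in(0,1)$, the processes produced by the algorithm with $V=1/\varepsilon$ satisfy, for every integer $T\ge1/\varepsilon^2$, $$\frac1T\sum_{t=0}^{T-1}\sum_{n=1}^N\mathbb E[y^n[t]]\le f_*+C\varepsilon,\qquad \frac1T\sum_{t=0}^{T-1}\sum_{n=1}^N\mathbb E[z^n_l[t]]\le d_l+C\varepsilon\quad(l=1,\dots,L).$$ That is, the algorithm gives an $O(\varepsilon)$ approximation with convergence time $O(1/\varepsilon^2)$. -/

import Mathlib

open MeasureTheory ProbabilityTheory Filter Topology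

universe u v

noncomputable section

/-- What happens during one renewal frame: `o.1` is the duration of the frame (in slots), and for
`j < o.1`, `(o.2 j).1` is the penalty and `(o.2 j).2` the vector of performance metrics incurred in
the `j`-th slot of the frame.  Entries with `j ≥ o.1` carry no meaning. -/
abbrev Frame (L : ℕ) : Type := ℕ × (ℕ → ℝ × (Fin L → ℝ))

namespace Frame

variable {L : ℕ}

/-- Erase the meaningless entries of a frame. -/
def trunc (o : Frame L) : Frame L := (o.1, fun j => if j < o.1 then o.2 j else 0)

/-- Total penalty over the frame. -/
def totalPenalty (o : Frame L) : ℝ := ∑ j ∈ Finset.range o.1, (o.2 j).1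

/-- Total of the `l`-th performance metric over the frame. -/
def totalMetric (o : Frame L) (l : Fin L) : ℝ := ∑ j ∈ Finset.range o.1, (o.2 j).2 l

end Frame

/-- `N` renewal systems with `L` performance metrics.  System `n` has the action set `A n`; using the
action `a` for a frame makes the frame (duration, and penalty and metrics slot by slot) distributed
as `frameLaw n a`.  The external process `d[t]` has one-slot distribution `extLaw`. -/
structure RenewalModel (N L : ℕ) where
  A : Fin N → Type u
  [measA : ∀ n, MeasurableSpace (A n)]
  frameLaw : ∀ n, Kernel (A n) (Frame L)
  [markov : ∀ n, IsMarkovKernel (frameLaw n)]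
  duration_pos : ∀ n a, ∀ᵐ o ∂(frameLaw n a), 1 ≤ o.1
  extLaw : Measure (Fin L → ℝ)
  [prob_extLaw : IsProbabilityMeasure extLaw]

attribute [instance] RenewalModel.measA RenewalModel.markov RenewalModel.prob_extLaw

namespace RenewalModel

variable {N L : ℕ} (M : RenewalModel.{u} N L)

/-- `d_l = E[d_l[t]]`. -/
def d (l : Fin L) : ℝ := ∫ x, x l ∂M.extLaw

/-- Expected total penalty of a frame of system `n` under the action `a`. -/
def yHat (n : Fin N) (a : M.A n) : ℝ := ∫ o, o.totalPenalty ∂(M.frameLaw n a)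

/-- Expected totals of the metrics of a frame of system `n` under the action `a`. -/
def zHat (n : Fin N) (a : M.A n) (l : Fin L) : ℝ := ∫ o, o.totalMetric l ∂(M.frameLaw n a)

/-- Expected duration of a frame of system `n` under the action `a`. -/
def THat (n : Fin N) (a : M.A n) : ℝ := ∫ o, (o.1 : ℝ) ∂(M.frameLaw n a)

def fHat (n : Fin N) (a : M.A n) : ℝ := M.yHat n a / M.THat n a

def gHat (n : Fin N) (a : M.A n) (l : Fin L) : ℝ := M.zHat n a l / M.THat n a

/-- Boundedness: penalties, metrics and the external process are bounded, and so are the conditional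
second moments of the residual lifetimes of the frames. -/
structure IsBounded (ymax zmax dmax B : ℝ) : Prop where
  penalty : ∀ n a, ∀ᵐ o ∂(M.frameLaw n a), ∀ j < o.1, |(o.2 j).1| ≤ ymax
  metric : ∀ n a, ∀ᵐ o ∂(M.frameLaw n a), ∀ j < o.1, ∀ l, |(o.2 j).2 l| ≤ zmax
  ext : ∀ᵐ x ∂M.extLaw, ∀ l, |x l| ≤ dmax
  one_le : 1 ≤ B
  residual : ∀ n a, ∀ s : ℕ, M.frameLaw n a {o | s ≤ o.1} ≠ 0 →
    ∫⁻ o, ENNReal.ofReal (((o.1 : ℝ) - (s : ℝ)) ^ 2) ∂((M.frameLaw n a)[|{o | s ≤ o.1}])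
      ≤ ENNReal.ofReal B

/-- For each system the set of performance vectors `(f̂(a), ĝ(a))` is compact. -/
def IsCompactPerformance : Prop :=
  ∀ n, IsCompact (Set.range fun a : M.A n => (M.fHat n a, M.gHat n a))

/-- The convex hull of the vectors `(ŷ(a), ẑ(a), T̂(a))`. -/
def hullS (n : Fin N) : Set (ℝ × (Fin L → ℝ) × ℝ) :=
  convexHull ℝ (Set.range fun a : M.A n => (M.yHat n a, M.zHat n a, M.THat n a))

/-- The performance region of system `n`. -/
def perfRegion (n : Fin N) : Set (ℝ × (Fin L → ℝ)) :=
  (fun p : ℝ × (Fin L → ℝ) × ℝ => (p.1 / p.2.2, fun l => p.2.1 l / p.2.2)) '' M.hullS n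

/-- The `σ`-algebra generated by all that is seen in slots `0, …, t - 1`: penalties, metrics, the
external process, the actions taken in these slots, and the frames that ended in them (so that
`{renewal k of system n is at slot ≤ t}` belongs to it). -/
abbrev historyOf {Ω : Type v} (renewal : Fin N → ℕ → Ω → ℕ) (act : ∀ n, ℕ → Ω → M.A n)
    (y : Fin N → ℕ → Ω → ℝ) (z : Fin N → ℕ → Ω → Fin L → ℝ) (ext : ℕ → Ω → Fin L → ℝ)
    (t : ℕ) : MeasurableSpace Ω :=
  (⨆ (n : Fin N) (s : ℕ) (_ : s < t), MeasurableSpace.comap (y n s) inferInstance) ⊔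
  (⨆ (n : Fin N) (s : ℕ) (_ : s < t), MeasurableSpace.comap (z n s) inferInstance) ⊔
  (⨆ (s : ℕ) (_ : s < t), MeasurableSpace.comap (ext s) inferInstance) ⊔
  MeasurableSpace.generateFrom
    {E | ∃ (n : Fin N) (k s : ℕ), s ≤ t ∧ E = {ω | renewal n k ω ≤ s}} ⊔
  MeasurableSpace.generateFrom
    {E | ∃ (n : Fin N) (k s : ℕ) (C : Set (M.A n)), s < t ∧ MeasurableSet C ∧
      E = {ω | renewal n k ω = s ∧ act n k ω ∈ C}}

/-- The frame of the slot processes `y`, `z` (of one system) over the slots `r, …, r' - 1`. -/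
def frameOf (y : ℕ → ℝ) (z : ℕ → Fin L → ℝ) (r r' : ℕ) : Frame L :=
  (r' - r, fun j => if j < r' - r then (y (r + j), z (r + j)) else 0)

/-- The stochastic processes resulting from the use of some decision sequences `act n k` in the `N`
renewal systems, on the probability space `(Ω, P)`. Decisions may be random, and may depend on the
past of all systems.

* `renewal n k` is the slot `t^n_k` of the `k`-th renewal of system `n`;
* `renewal_property`: given the action chosen at `t^n_k`, the `k`-th frame of system `n` is
  independent of the history of all systems before `t^n_k`, and is distributed as prescribed by the
  action. It is written in integrated form, over all events `H` of the history up to slot `t`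
  (intersected with `{t^n_k = t}`) and all events `{act n k ∈ C}`.
* `ext_law` and `ext_indep`: the `d[t]` are i.i.d., external to the systems. -/
structure Run {Ω : Type v} [MeasurableSpace Ω] (P : Measure Ω) where
  renewal : Fin N → ℕ → Ω → ℕ
  act : ∀ n, ℕ → Ω → M.A n
  y : Fin N → ℕ → Ω → ℝ
  z : Fin N → ℕ → Ω → Fin L → ℝ
  ext : ℕ → Ω → Fin L → ℝ
  measurable_renewal : ∀ n k, Measurable (renewal n k)
  measurable_act : ∀ n k, Measurable (act n k)
  measurable_y : ∀ n t, Measurable (y n t)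
  measurable_z : ∀ n t, Measurable (z n t)
  measurable_ext : ∀ t, Measurable (ext t)
  renewal_zero : ∀ n ω, renewal n 0 ω = 0
  renewal_lt : ∀ n k ω, renewal n k ω < renewal n (k + 1) ω
  renewal_property : ∀ (n : Fin N) (k t : ℕ) (H : Set Ω) (C : Set (M.A n)) (E : Set (Frame L)),
    MeasurableSet[M.historyOf renewal act y z ext t] H → MeasurableSet C → MeasurableSet E →
    P (H ∩ {ω | renewal n k ω = t} ∩ {ω | act n k ω ∈ C} ∩
        {ω | frameOf (fun s => y n s ω) (fun s => z n s ω)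
          (renewal n k ω) (renewal n (k + 1) ω) ∈ E}) =
      ∫⁻ ω in H ∩ {ω | renewal n k ω = t} ∩ {ω | act n k ω ∈ C},
        M.frameLaw n (act n k ω) (Frame.trunc ⁻¹' E) ∂P
  ext_law : ∀ t, P.map (ext t) = M.extLaw
  ext_indep : ∀ t, Indep (MeasurableSpace.comap (ext t) inferInstance)
    (M.historyOf renewal act y z ext t) P

namespace Run

variable {M} {Ω : Type v} [MeasurableSpace Ω] {P : Measure Ω} (R : M.Run P)

/-- `(1/T) ∑_{t<T} ∑_n E[y^n[t]]`. -/
def avgPenalty (T : ℕ) : ℝ :=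
  (1 / (T : ℝ)) * ∑ t ∈ Finset.range T, ∑ n, ∫ ω, R.y n t ω ∂P

/-- `(1/T) ∑_{t<T} ∑_n E[z^n_l[t]]`. -/
def avgMetric (l : Fin L) (T : ℕ) : ℝ :=
  (1 / (T : ℝ)) * ∑ t ∈ Finset.range T, ∑ n, ∫ ω, R.z n t ω l ∂P

/-- The long-term constraints. -/
def MeetsConstraints : Prop := ∀ l, limsup (R.avgMetric l) atTop ≤ M.d l

/-- The virtual queues. -/
def Q (ω : Ω) : ℕ → Fin L → ℝ
  | 0 => fun _ => 0
  | t + 1 => fun l => max (Q ω t l + ∑ n, R.z n t ω l - R.ext t ω l) 0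

end Run

/-- The drift-plus-penalty ratio of action `a` of system `n`, for trade-off parameter `V`, when the
virtual queues are `q` at the start of the frame. -/
def dppRatio (V : ℝ) (q : Fin L → ℝ) (n : Fin N) (a : M.A n) : ℝ :=
  (∫ o, ∑ j ∈ Finset.range o.1, (V * (o.2 j).1 + ∑ l, q l * (o.2 j).2 l) ∂(M.frameLaw n a)) /
    ∫ o, (o.1 : ℝ) ∂(M.frameLaw n a)

/-- The run is produced by the proposed algorithm with trade-off parameter `V`: in every frame of
every system the action minimizes the drift-plus-penalty ratio for the virtual queues observed at the
start of the frame (ties may be broken in any way). -/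
def Run.FollowsAlgorithm {M : RenewalModel.{u} N L} {Ω : Type v} [MeasurableSpace Ω] {P : Measure Ω}
    (R : M.Run P) (V : ℝ) : Prop :=
  ∀ᵐ ω ∂P, ∀ n k, ∀ a : M.A n,
    M.dppRatio V (R.Q ω (R.renewal n k ω)) n (R.act n k ω) ≤
      M.dppRatio V (R.Q ω (R.renewal n k ω)) n a

/-- The objective values of the runs that satisfy the long-term constraints, over all decision
sequences on all probability spaces. -/
def feasibleValues : Set ℝ :=
  {x | ∃ (Ω : Type u) (_ : MeasurableSpace Ω) (P : Measure Ω) (_ : IsProbabilityMeasure P)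
    (R : M.Run P), R.MeetsConstraints ∧ x = limsup R.avgPenalty atTop}

/-- The constrained problem is feasible. -/
def Feasible : Prop := M.feasibleValues.Nonempty

/-- The optimal value of the constrained problem. -/
def fStar : ℝ := sInf M.feasibleValues

/-- `(1, γ_1, …, γ_L)`, with all `γ_l ≥ 0`, is normal to a (non-vertical) separating hyperplane. -/
def IsLagrangeMultiplier (γ : Fin L → ℝ) : Prop :=
  (∀ l, 0 ≤ γ l) ∧
  ∀ p : Fin N → ℝ × (Fin L → ℝ), (∀ n, p n ∈ M.perfRegion n) →
    M.fStar + ∑ l, γ l * M.d l ≤ ∑ n, (p n).1 + ∑ l, γ l * ∑ n, (p n).2 l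

end RenewalModel

end

/-! Fix weights v and q. Over a frame of system n run with action a, the mean total of v·y + ⟨q, z⟩
equals `ratio v q n a` times the mean length. By the renewal property, the slotwise deviations from
this ratio (the scores) therefore sum to zero in expectation over a complete frame. This remains
true when q is random, provided it is determined by the history before the frame. So the expected
sum of the scores before a deterministic time T comes only from the frame straddling T, whose
overshoot has mean at most B by the residual-lifetime assumption. This is
`abs_integral_sum_blockScore_le`, and it is used three times.

Constant weights (V, q) with q ≥ 0, on any run meeting the constraints: dividing by T and letting T
→ ∞ gives ∑ₙ `minRatio V q n` ≤ V f_* + ⟨q, d⟩ for every q (`IsBounded.sum_minRatio_le`). No optimal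
stationary policy has to be constructed.

Constant weights (1, γ), on the algorithm's own run: with the multiplier inequality, its total
penalty before T is at least T f_* - ⟨γ, E Q[T]⟩ - const.

Queue weights Q[t_k], on the algorithm's run: its actions attain `minRatio` at Q[t_k]. Replacing
Q[t_k] by the current Q[t] costs a multiple of the squared frame length, and the expected squares of
the frames starting before T sum to at most B T (`FollowsAlgorithm.integral_sum_sub_minRatio_le`).

The quadratic drift of the queues, the third use and the first one at q = Q[t] give ½ ∑ E Q_l[T]² +
V · (total penalty) ≤ V T f_* + O(T + V). Dropping the squares bounds the penalty. Inserting the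
lower bound from the second use and completing the square gives ∑ (E Q_l[T])² = O(T + V²) = O(T),
because V² = 1/ε² ≤ T. The average violation of constraint l is at most E Q_l[T] / T = O(1/√T) =
O(ε). -/

noncomputable section

/-! ### Frames: measurability, truncation, crude bounds -/

namespace Frame

variable {L : ℕ}

lemma measurable_of_fst {β : Type*} [MeasurableSpace β] {f : Frame L → β}
    (h : ∀ m : ℕ, Measurable fun p : ℕ → ℝ × (Fin L → ℝ) => f (m, p)) : Measurable f :=
  measurable_from_prod_countable_right h

lemma measurable_trunc : Measurable (trunc : Frame L → Frame L) := by
  refine measurable_of_fst fun m => ?_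
  refine measurable_const.prodMk (measurable_pi_lambda _ fun j => ?_)
  by_cases h : j < m
  · simpa [h] using (measurable_pi_apply j : Measurable fun p : ℕ → ℝ × (Fin L → ℝ) => p j)
  · simp [h]

lemma measurable_totalPenalty : Measurable (totalPenalty : Frame L → ℝ) := by
  refine measurable_of_fst fun m => ?_
  simp only [totalPenalty]
  fun_prop

lemma measurable_totalMetric (l : Fin L) : Measurable fun o : Frame L => o.totalMetric l := by
  refine measurable_of_fst fun m => ?_
  simp only [totalMetric]
  fun_prop

lemma measurable_frameOf {Ω : Type*} [MeasurableSpace Ω] {y : ℕ → Ω → ℝ} {z : ℕ → Ω → Fin L → ℝ}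
    {r r' : Ω → ℕ} (hy : ∀ t, Measurable (y t)) (hz : ∀ t, Measurable (z t)) (hr : Measurable r)
    (hr' : Measurable r') :
    Measurable fun ω => RenewalModel.frameOf (fun s => y s ω) (fun s => z s ω) (r ω) (r' ω) := by
  have h : Measurable fun p : (ℕ × ℕ) × Ω =>
      RenewalModel.frameOf (fun s => y s p.2) (fun s => z s p.2) p.1.1 p.1.2 := by
    refine measurable_from_prod_countable_right fun p => ?_
    refine Measurable.prodMk (f := fun _ => p.2 - p.1) measurable_const
      (measurable_pi_lambda _ fun j => ?_)
    by_cases h : j < p.2 - p.1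
    · simpa [h] using (hy _).prodMk (hz _)
    · simp [h]
  exact h.comp ((hr.prodMk hr').prodMk measurable_id)

@[simp] lemma totalPenalty_trunc (o : Frame L) : o.trunc.totalPenalty = o.totalPenalty := by
  refine Finset.sum_congr rfl fun j hj => ?_
  have hj' : j < o.1 := Finset.mem_range.1 hj
  simp [trunc, hj']

@[simp] lemma totalMetric_trunc (o : Frame L) (l : Fin L) :
    o.trunc.totalMetric l = o.totalMetric l := by
  refine Finset.sum_congr rfl fun j hj => ?_
  have hj' : j < o.1 := Finset.mem_range.1 hj
  simp [trunc, hj']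

@[simp] lemma trunc_fst (o : Frame L) : o.trunc.1 = o.1 := rfl

lemma abs_totalPenalty_le {o : Frame L} {Y : ℝ} (h : ∀ j < o.1, |(o.2 j).1| ≤ Y) :
    |o.totalPenalty| ≤ Y * o.1 := by
  refine (Finset.abs_sum_le_sum_abs _ _).trans ?_
  refine (Finset.sum_le_sum fun j hj => h j (Finset.mem_range.1 hj)).trans ?_
  simp [mul_comm]

lemma abs_totalMetric_le {o : Frame L} {Z : ℝ} {l : Fin L} (h : ∀ j < o.1, |(o.2 j).2 l| ≤ Z) :
    |o.totalMetric l| ≤ Z * o.1 := by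
  refine (Finset.abs_sum_le_sum_abs _ _).trans ?_
  refine (Finset.sum_le_sum fun j hj => h j (Finset.mem_range.1 hj)).trans ?_
  simp [mul_comm]

end Frame

/-! ### Conditional law of a frame given the past and the action -/

namespace RenewalModel

variable {N L : ℕ} {M : RenewalModel.{u} N L} {ymax zmax dmax B : ℝ}

/-- The law of the meaningful part of a frame, as a kernel that forgets an additional variable. -/
def truncLaw (M : RenewalModel.{u} N L) (n : Fin N) (S : Type*) [MeasurableSpace S] :
    Kernel (S × M.A n) (Frame L) :=
  ((M.frameLaw n).map Frame.trunc).comap Prod.snd measurable_snd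

instance (n : Fin N) (S : Type*) [MeasurableSpace S] : IsMarkovKernel (M.truncLaw n S) := by
  have := Kernel.IsMarkovKernel.map (M.frameLaw n) (Frame.measurable_trunc (L := L))
  unfold truncLaw
  infer_instance

lemma truncLaw_apply (n : Fin N) {S : Type*} [MeasurableSpace S] (x : S × M.A n) :
    M.truncLaw n S x = (M.frameLaw n x.2).map Frame.trunc := by
  rw [truncLaw, Kernel.comap_apply, Kernel.map_apply _ Frame.measurable_trunc]

namespace Run

variable {Ω : Type v} [mΩ : MeasurableSpace Ω] {P : Measure Ω} (R : M.Run P)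

/-- The history of a run before slot `t`. -/
abbrev history (t : ℕ) : MeasurableSpace Ω := M.historyOf R.renewal R.act R.y R.z R.ext t

/-- The `k`-th frame of system `n`. -/
def frame (n : Fin N) (k : ℕ) (ω : Ω) : Frame L :=
  frameOf (fun s => R.y n s ω) (fun s => R.z n s ω) (R.renewal n k ω) (R.renewal n (k + 1) ω)

/-- The duration of the `k`-th frame of system `n`. -/
def duration (n : Fin N) (k : ℕ) (ω : Ω) : ℕ := R.renewal n (k + 1) ω - R.renewal n k ω

lemma measurable_duration (n : Fin N) (k : ℕ) : Measurable (R.duration n k) :=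
  (R.measurable_renewal n (k + 1)).sub (R.measurable_renewal n k)

lemma measurable_frame (n : Fin N) (k : ℕ) : Measurable (R.frame n k) :=
  Frame.measurable_frameOf (R.measurable_y n) (R.measurable_z n) (R.measurable_renewal n k)
    (R.measurable_renewal n (k + 1))

lemma history_le (t : ℕ) : R.history t ≤ mΩ := by
  refine sup_le (sup_le (sup_le (sup_le ?_ ?_) ?_) ?_) ?_
  · exact iSup_le fun n => iSup_le fun s => iSup_le fun _ => (R.measurable_y n s).comap_le
  · exact iSup_le fun n => iSup_le fun s => iSup_le fun _ => (R.measurable_z n s).comap_le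
  · exact iSup_le fun s => iSup_le fun _ => (R.measurable_ext s).comap_le
  · refine MeasurableSpace.generateFrom_le ?_
    rintro _ ⟨n, k, s, -, rfl⟩
    exact R.measurable_renewal n k measurableSet_Iic
  · refine MeasurableSpace.generateFrom_le ?_
    rintro _ ⟨n, k, s, C, -, hC, rfl⟩
    exact (R.measurable_renewal n k (measurableSet_singleton s)).inter (R.measurable_act n k hC)

lemma measurable_history_z (n : Fin N) {s t : ℕ} (h : s < t) : Measurable[R.history t] (R.z n s) := by
  refine Measurable.of_comap_le (le_trans ?_ (le_sup_right.trans (le_sup_left.trans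
    (le_sup_left.trans le_sup_left))))
  exact le_iSup_of_le n (le_iSup_of_le s (le_iSup_of_le h le_rfl))

lemma measurable_history_ext {s t : ℕ} (h : s < t) : Measurable[R.history t] (R.ext s) := by
  refine Measurable.of_comap_le (le_trans ?_ (le_sup_right.trans (le_sup_left.trans le_sup_left)))
  exact le_iSup_of_le s (le_iSup_of_le h le_rfl)

lemma measurable_history_Q {s t : ℕ} (h : s ≤ t) :
    Measurable[R.history t] fun ω => R.Q ω s := by
  induction s with
  | zero => exact @measurable_const _ _ _ (R.history t) _
  | succ s ih =>
    have ih := ih (by omega)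
    have hz := fun n => R.measurable_history_z n (show s < t by omega)
    have he := R.measurable_history_ext (show s < t by omega)
    refine @measurable_pi_lambda _ _ _ (R.history t) _ _ fun l => ?_
    have hQ : Measurable[R.history t] fun ω => R.Q ω s l := (measurable_pi_apply l).comp ih
    have hzl : ∀ n, Measurable[R.history t] fun ω => R.z n s ω l :=
      fun n => (measurable_pi_apply l).comp (hz n)
    have hel : Measurable[R.history t] fun ω => R.ext s ω l := (measurable_pi_apply l).comp he
    exact ((hQ.add (Finset.measurable_fun_sum _ fun n _ => hzl n)).sub hel).max measurable_const

lemma measurable_Q (t : ℕ) : Measurable fun ω => R.Q ω t :=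
  (R.measurable_history_Q le_rfl).mono (R.history_le t) le_rfl

lemma measurableSet_renewal_eq (n : Fin N) (k s : ℕ) :
    MeasurableSet {ω | R.renewal n k ω = s} :=
  R.measurable_renewal n k (measurableSet_singleton s)

/-- Given the past `ψ` and the action chosen at the `k`-th renewal, the `k`-th frame has the law
prescribed by the action. -/
theorem map_restrict_eq_compProd [IsFiniteMeasure P] (n : Fin N) (k s : ℕ) {S : Type*}
    [MeasurableSpace S] {ψ : Ω → S} (hψ : Measurable[R.history s] ψ) :
    (P.restrict {ω | R.renewal n k ω = s}).map (fun ω => ((ψ ω, R.act n k ω), R.frame n k ω)) =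
      (P.restrict {ω | R.renewal n k ω = s}).map (fun ω => (ψ ω, R.act n k ω)) ⊗ₘ
        M.truncLaw n S := by
  have hψ' : Measurable ψ := hψ.mono (R.history_le s) le_rfl
  have h2 : Measurable fun ω => (ψ ω, R.act n k ω) := hψ'.prodMk (R.measurable_act n k)
  have h3 : Measurable fun ω => ((ψ ω, R.act n k ω), R.frame n k ω) :=
    h2.prodMk (R.measurable_frame n k)
  -- It suffices to compare the measures on boxes A × C × E, where the identity is the integrated
  -- renewal property with H = ψ⁻¹(A).
  refine Measure.ext_prod₃' fun {A C E} hA hC hE => ?_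
  rw [Measure.map_apply h3 ((hA.prod hC).prod hE), Measure.compProd_apply_prod (hA.prod hC) hE,
    setLIntegral_map (hA.prod hC) (Kernel.measurable_coe _ hE) h2,
    Measure.restrict_apply (h3 ((hA.prod hC).prod hE)),
    Measure.restrict_restrict (h2 (hA.prod hC))]
  have hp := R.renewal_property n k s (ψ ⁻¹' A) C E (hψ hA) hC hE
  have e1 : (fun ω => ((ψ ω, R.act n k ω), R.frame n k ω)) ⁻¹' ((A ×ˢ C) ×ˢ E) ∩
      {ω | R.renewal n k ω = s} = ψ ⁻¹' A ∩ {ω | R.renewal n k ω = s} ∩ {ω | R.act n k ω ∈ C} ∩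
        {ω | frameOf (fun s => R.y n s ω) (fun s => R.z n s ω)
          (R.renewal n k ω) (R.renewal n (k + 1) ω) ∈ E} := by
    ext ω
    simp only [frame, Set.mem_inter_iff, Set.mem_preimage, Set.mem_prod, Set.mem_ofPred_eq]
    tauto
  have e2 : (fun ω => (ψ ω, R.act n k ω)) ⁻¹' (A ×ˢ C) ∩ {ω | R.renewal n k ω = s} =
      ψ ⁻¹' A ∩ {ω | R.renewal n k ω = s} ∩ {ω | R.act n k ω ∈ C} := by
    ext ω
    simp only [Set.mem_inter_iff, Set.mem_preimage, Set.mem_prod, Set.mem_ofPred_eq]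
    tauto
  rw [e1, hp, e2]
  refine lintegral_congr fun ω => ?_
  rw [truncLaw_apply, Measure.map_apply Frame.measurable_trunc hE]

/-- Tower rule on {t_k = s}: the frame is averaged first, with the action and the past frozen. The
variable ψ carries whatever part of the past the integrand needs, such as the queues. -/
lemma lintegral_frame [IsFiniteMeasure P] (n : Fin N) (k s : ℕ) {S : Type*}
    [MeasurableSpace S] {ψ : Ω → S} (hψ : Measurable[R.history s] ψ)
    {F : (S × M.A n) × Frame L → ENNReal} (hF : Measurable F) :
    ∫⁻ ω in {ω | R.renewal n k ω = s}, F ((ψ ω, R.act n k ω), R.frame n k ω) ∂P =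
      ∫⁻ ω in {ω | R.renewal n k ω = s},
        ∫⁻ o, F ((ψ ω, R.act n k ω), o.trunc) ∂(M.frameLaw n (R.act n k ω)) ∂P := by
  have hψ' : Measurable ψ := hψ.mono (R.history_le s) le_rfl
  have h2 : Measurable fun ω => (ψ ω, R.act n k ω) := hψ'.prodMk (R.measurable_act n k)
  have h3 : Measurable fun ω => ((ψ ω, R.act n k ω), R.frame n k ω) :=
    h2.prodMk (R.measurable_frame n k)
  rw [← lintegral_map hF h3, R.map_restrict_eq_compProd n k s hψ, Measure.lintegral_compProd hF,
    lintegral_map hF.lintegral_kernel_prod_right' h2]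
  refine lintegral_congr fun ω => ?_
  rw [truncLaw_apply, lintegral_map (f := fun o => F ((ψ ω, R.act n k ω), o))
    (hF.comp measurable_prodMk_left) Frame.measurable_trunc]

lemma integral_frame [IsFiniteMeasure P] (n : Fin N) (k s : ℕ) {S : Type*}
    [MeasurableSpace S] {ψ : Ω → S} (hψ : Measurable[R.history s] ψ)
    {F : (S × M.A n) × Frame L → ℝ} (hF : Measurable F)
    (hi : IntegrableOn (fun ω => F ((ψ ω, R.act n k ω), R.frame n k ω))
      {ω | R.renewal n k ω = s} P) :
    ∫ ω in {ω | R.renewal n k ω = s}, F ((ψ ω, R.act n k ω), R.frame n k ω) ∂P =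
      ∫ ω in {ω | R.renewal n k ω = s},
        ∫ o, F ((ψ ω, R.act n k ω), o.trunc) ∂(M.frameLaw n (R.act n k ω)) ∂P := by
  have hψ' : Measurable ψ := hψ.mono (R.history_le s) le_rfl
  have h2 : Measurable fun ω => (ψ ω, R.act n k ω) := hψ'.prodMk (R.measurable_act n k)
  have h3 : Measurable fun ω => ((ψ ω, R.act n k ω), R.frame n k ω) :=
    h2.prodMk (R.measurable_frame n k)
  have hi' := (integrable_map_measure hF.aestronglyMeasurable h3.aemeasurable).2 hi
  rw [R.map_restrict_eq_compProd n k s hψ] at hi'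
  rw [← integral_map h3.aemeasurable hF.aestronglyMeasurable, R.map_restrict_eq_compProd n k s hψ,
    Measure.integral_compProd hi', integral_map h2.aemeasurable
      hF.stronglyMeasurable.integral_kernel_prod_right'.aestronglyMeasurable]
  refine integral_congr_ae (ae_of_all _ fun ω => ?_)
  dsimp only
  rw [truncLaw_apply, integral_map (f := fun o => F ((ψ ω, R.act n k ω), o))
    Frame.measurable_trunc.aemeasurable
    (hF.comp measurable_prodMk_left).aestronglyMeasurable]

end Run

/-! ### Mean performance of one frame under a fixed action -/

lemma measurable_length : Measurable fun o : Frame L => (o.1 : ℝ) :=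
  (measurable_from_nat (f := fun m : ℕ => (m : ℝ))).comp measurable_fst

lemma measurable_THat (M : RenewalModel.{u} N L) (n : Fin N) : Measurable (M.THat n) :=
  (StronglyMeasurable.integral_kernel (κ := M.frameLaw n)
    measurable_length.stronglyMeasurable).measurable

lemma measurable_fHat (M : RenewalModel.{u} N L) (n : Fin N) : Measurable (M.fHat n) :=
  (StronglyMeasurable.integral_kernel (κ := M.frameLaw n)
    Frame.measurable_totalPenalty.stronglyMeasurable).measurable.div (M.measurable_THat n)

lemma measurable_gHat (M : RenewalModel.{u} N L) (n : Fin N) (l : Fin L) :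
    Measurable fun a => M.gHat n a l :=
  (StronglyMeasurable.integral_kernel (κ := M.frameLaw n)
    (Frame.measurable_totalMetric l).stronglyMeasurable).measurable.div (M.measurable_THat n)

namespace IsBounded

lemma setLIntegral_residual_le (hb : M.IsBounded ymax zmax dmax B) (n : Fin N) (a : M.A n) (s : ℕ) :
    ∫⁻ o in {o | s ≤ o.1}, ENNReal.ofReal (((o.1 : ℝ) - (s : ℝ)) ^ 2) ∂(M.frameLaw n a) ≤
      ENNReal.ofReal B * M.frameLaw n a {o | s ≤ o.1} := by
  by_cases h0 : M.frameLaw n a {o | s ≤ o.1} = 0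
  · rw [setLIntegral_measure_zero _ _ h0]
    exact zero_le
  · have h := hb.residual n a s h0
    rw [ProbabilityTheory.cond, lintegral_smul_measure, smul_eq_mul, mul_comm, ← div_eq_mul_inv] at h
    exact (ENNReal.div_le_iff h0 (measure_ne_top _ _)).1 h

/-- Since m ≤ m² for natural numbers, the second-moment assumption controls the first moment;
truncated subtraction makes the integrand vanish off {s ≤ o.1}. -/
lemma lintegral_residual_le (hb : M.IsBounded ymax zmax dmax B) (n : Fin N) (a : M.A n) (s : ℕ) :
    ∫⁻ o, ENNReal.ofReal ((o.1 - s : ℕ) : ℝ) ∂(M.frameLaw n a) ≤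
      ENNReal.ofReal B * M.frameLaw n a {o | s ≤ o.1} := by
  have hm : MeasurableSet {o : Frame L | s ≤ o.1} := measurable_fst measurableSet_Ici
  refine le_trans ?_ (hb.setLIntegral_residual_le n a s)
  rw [← lintegral_indicator hm]
  refine lintegral_mono fun o => ?_
  by_cases h : s ≤ o.1
  · have hmem : o ∈ {o : Frame L | s ≤ o.1} := h
    rw [Set.indicator_of_mem hmem]
    refine ENNReal.ofReal_le_ofReal ?_
    rw [← Nat.cast_sub h]
    exact_mod_cast Nat.le_self_pow two_ne_zero _
  · simp [Nat.sub_eq_zero_of_le (not_le.1 h).le]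

lemma lintegral_sq_le (hb : M.IsBounded ymax zmax dmax B) (n : Fin N) (a : M.A n) :
    ∫⁻ o, ENNReal.ofReal ((o.1 : ℝ) ^ 2) ∂(M.frameLaw n a) ≤ ENNReal.ofReal B := by
  simpa using hb.setLIntegral_residual_le n a 0

lemma integrable_length (hb : M.IsBounded ymax zmax dmax B) (n : Fin N) (a : M.A n) :
    Integrable (fun o : Frame L => (o.1 : ℝ)) (M.frameLaw n a) := by
  refine ⟨measurable_length.aestronglyMeasurable, ?_⟩
  rw [hasFiniteIntegral_iff_ofReal (ae_of_all _ fun o => by positivity)]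
  refine lt_of_le_of_lt (lintegral_mono fun o => ENNReal.ofReal_le_ofReal ?_)
    ((hb.lintegral_sq_le n a).trans_lt ENNReal.ofReal_lt_top)
  exact_mod_cast Nat.le_self_pow two_ne_zero _

lemma ae_abs_totalPenalty_le (hb : M.IsBounded ymax zmax dmax B) (n : Fin N) (a : M.A n) :
    ∀ᵐ o ∂(M.frameLaw n a), |o.totalPenalty| ≤ |ymax| * o.1 := by
  filter_upwards [hb.penalty n a] with o ho
  exact Frame.abs_totalPenalty_le fun j hj => (ho j hj).trans (le_abs_self _)

lemma ae_abs_totalMetric_le (hb : M.IsBounded ymax zmax dmax B) (n : Fin N) (a : M.A n)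
    (l : Fin L) : ∀ᵐ o ∂(M.frameLaw n a), |o.totalMetric l| ≤ |zmax| * o.1 := by
  filter_upwards [hb.metric n a] with o ho
  exact Frame.abs_totalMetric_le fun j hj => (ho j hj l).trans (le_abs_self _)

lemma integrable_totalPenalty (hb : M.IsBounded ymax zmax dmax B) (n : Fin N) (a : M.A n) :
    Integrable Frame.totalPenalty (M.frameLaw n a) :=
  ((hb.integrable_length n a).const_mul |ymax|).mono'
    Frame.measurable_totalPenalty.aestronglyMeasurable (hb.ae_abs_totalPenalty_le n a)

lemma integrable_totalMetric (hb : M.IsBounded ymax zmax dmax B) (n : Fin N) (a : M.A n)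
    (l : Fin L) : Integrable (fun o : Frame L => o.totalMetric l) (M.frameLaw n a) :=
  ((hb.integrable_length n a).const_mul |zmax|).mono'
    (Frame.measurable_totalMetric l).aestronglyMeasurable (hb.ae_abs_totalMetric_le n a l)

lemma one_le_THat (hb : M.IsBounded ymax zmax dmax B) (n : Fin N) (a : M.A n) :
    1 ≤ M.THat n a := by
  have h : ∫ _, (1 : ℝ) ∂(M.frameLaw n a) ≤ M.THat n a := by
    refine integral_mono_ae (integrable_const _) (hb.integrable_length n a) ?_
    filter_upwards [M.duration_pos n a] with o ho
    exact_mod_cast ho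
  simpa using h

lemma abs_fHat_le (hb : M.IsBounded ymax zmax dmax B) (n : Fin N) (a : M.A n) :
    |M.fHat n a| ≤ |ymax| := by
  have hT := hb.one_le_THat n a
  rw [fHat, abs_div, abs_of_pos (show 0 < M.THat n a by linarith), div_le_iff₀ (by linarith)]
  refine (abs_integral_le_integral_abs).trans ?_
  rw [THat, ← integral_const_mul]
  exact integral_mono_ae (hb.integrable_totalPenalty n a).abs
    ((hb.integrable_length n a).const_mul _) (hb.ae_abs_totalPenalty_le n a)

lemma abs_gHat_le (hb : M.IsBounded ymax zmax dmax B) (n : Fin N) (a : M.A n) (l : Fin L) :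
    |M.gHat n a l| ≤ |zmax| := by
  have hT := hb.one_le_THat n a
  rw [gHat, abs_div, abs_of_pos (show 0 < M.THat n a by linarith), div_le_iff₀ (by linarith)]
  refine (abs_integral_le_integral_abs).trans ?_
  rw [THat, ← integral_const_mul]
  exact integral_mono_ae (hb.integrable_totalMetric n a l).abs
    ((hb.integrable_length n a).const_mul _) (hb.ae_abs_totalMetric_le n a l)

/-- For r = v f̂(a) + ⟨q, ĝ(a)⟩ the right-hand side is zero; this is the centering behind the
scores. -/
lemma integral_weighted (hb : M.IsBounded ymax zmax dmax B) (v r : ℝ) (q : Fin L → ℝ) (n : Fin N)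
    (a : M.A n) :
    ∫ o, (v * o.totalPenalty + ∑ l, q l * o.totalMetric l - r * o.1) ∂(M.frameLaw n a) =
      (v * M.fHat n a + ∑ l, q l * M.gHat n a l - r) * M.THat n a := by
  have hT := hb.one_le_THat n a
  have hy := (hb.integrable_totalPenalty n a).const_mul v
  have hz := fun l => (hb.integrable_totalMetric n a l).const_mul (q l)
  have hT' : M.THat n a ≠ 0 := by linarith
  have hz' : Integrable (fun o : Frame L => ∑ l, q l * o.totalMetric l) (M.frameLaw n a) :=
    integrable_finsetSum _ fun l _ => hz l
  have hyz : Integrable (fun o : Frame L => v * o.totalPenalty + ∑ l, q l * o.totalMetric l)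
      (M.frameLaw n a) := hy.add hz'
  rw [integral_sub hyz ((hb.integrable_length n a).const_mul r), integral_add hy hz',
    integral_finsetSum _ fun l _ => hz l, integral_const_mul, integral_const_mul]
  simp_rw [integral_const_mul]
  change v * M.yHat n a + ∑ l, q l * M.zHat n a l - r * M.THat n a = _
  rw [sub_mul, add_mul, Finset.sum_mul]
  congr 2
  · rw [fHat]; field_simp
  · refine Finset.sum_congr rfl fun l _ => ?_
    rw [gHat]; field_simp

lemma dppRatio_eq (hb : M.IsBounded ymax zmax dmax B) (v : ℝ) (q : Fin L → ℝ) (n : Fin N)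
    (a : M.A n) : M.dppRatio v q n a = v * M.fHat n a + ∑ l, q l * M.gHat n a l := by
  have hT := hb.one_le_THat n a
  have h := hb.integral_weighted v 0 q n a
  simp only [zero_mul, sub_zero] at h
  rw [dppRatio, show (∫ o, (o.1 : ℝ) ∂(M.frameLaw n a)) = M.THat n a from rfl,
    div_eq_iff (by linarith), ← h]
  refine integral_congr_ae (ae_of_all _ fun o => ?_)
  simp only [Frame.totalPenalty, Frame.totalMetric, Finset.mul_sum, Finset.sum_add_distrib]
  rw [Finset.sum_comm]

end IsBounded

end RenewalModel

/-! ### Cutting the time axis into blocks -/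

/-- The bound K t ≤ t comes from k ≤ τ k. It shows that the first T blocks cover all slots before T,
so that sums over frames have a deterministic finite range. -/
lemma exists_block_index {τ : ℕ → ℕ} (h0 : τ 0 = 0) (hτ : StrictMono τ) :
    ∃ K : ℕ → ℕ, (∀ t, K t ≤ t) ∧ ∀ t k, K t = k ↔ τ k ≤ t ∧ t < τ (k + 1) := by
  have hex : ∀ t, ∃ k, τ k ≤ t ∧ t < τ (k + 1) := by
    intro t
    induction t with
    | zero => exact ⟨0, h0.le, by have := hτ (Nat.lt_succ_self 0); simp_all⟩
    | succ t ih =>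
      obtain ⟨k, h1, h2⟩ := ih
      rcases Nat.lt_or_ge (t + 1) (τ (k + 1)) with h | h
      · exact ⟨k, by omega, h⟩
      · exact ⟨k + 1, h, lt_of_le_of_lt (by omega) (hτ (Nat.lt_succ_self (k + 1)))⟩
  choose K h1 h2 using hex
  refine ⟨K, fun t => (hτ.le_apply).trans (h1 t), fun t k => ⟨?_, ?_⟩⟩
  · rintro rfl
    exact ⟨h1 t, h2 t⟩
  · rintro ⟨h3, h4⟩
    have a := hτ.lt_iff_lt.1 ((h1 t).trans_lt h4)
    have b := hτ.lt_iff_lt.1 (h3.trans_lt (h2 t))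
    omega

lemma sum_blocks {τ : ℕ → ℕ} (h0 : τ 0 = 0) (hτ : StrictMono τ) (T : ℕ) (p : ℕ → ℝ) :
    ∑ k ∈ Finset.range T, ∑ t ∈ Finset.range T, (if τ k ≤ t ∧ t < τ (k + 1) then p t else 0) =
      ∑ t ∈ Finset.range T, p t := by
  obtain ⟨K, hK, hK'⟩ := exists_block_index h0 hτ
  rw [Finset.sum_comm]
  refine Finset.sum_congr rfl fun t ht => ?_
  simp_rw [← hK']
  rw [Finset.sum_ite_eq, if_pos]
  exact Finset.mem_range.2 ((hK t).trans_lt (Finset.mem_range.1 ht))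

/-- The two sums differ only on slots of [T, b). As a < T, the natural number b - a - (T - a) is the
positive part of b - T, written as the residual of the duration b - a at age T - a. -/
lemma abs_sum_block_sub_le {a b T : ℕ} (haT : a < T) {x : ℕ → ℝ} {D : ℝ} (hD : 0 ≤ D)
    (hx : ∀ t, |x t| ≤ D) :
    |(∑ t ∈ Finset.range T, if a ≤ t ∧ t < b then x t else 0) - ∑ t ∈ Finset.Ico a b, x t| ≤
      D * ((b - a - (T - a) : ℕ) : ℝ) := by
  rw [← Finset.sum_filter]
  have hsub : (Finset.range T).filter (fun t => a ≤ t ∧ t < b) ⊆ Finset.Ico a b := by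
    intro t
    simp only [Finset.mem_filter, Finset.mem_Ico]
    tauto
  rw [← Finset.sum_sdiff hsub, sub_add_cancel_right, abs_neg]
  refine (Finset.abs_sum_le_sum_abs _ _).trans ((Finset.sum_le_card_nsmul _ _ D
    fun t _ => hx t).trans ?_)
  rw [nsmul_eq_mul, mul_comm]
  refine mul_le_mul_of_nonneg_left ?_ hD
  have : Finset.Ico a b \ (Finset.range T).filter (fun t => a ≤ t ∧ t < b) ⊆ Finset.Ico T b := by
    intro t
    simp only [Finset.mem_filter, Finset.mem_Ico, Finset.mem_sdiff, Finset.mem_range]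
    omega
  have h2 := Finset.card_le_card this
  rw [Nat.card_Ico] at h2
  exact_mod_cast h2.trans (by omega)

/-! ### Almost sure bounds and residual lifetimes along a run -/

namespace RenewalModel

variable {N L : ℕ} {M : RenewalModel.{u} N L} {ymax zmax dmax B : ℝ}

/-- The performance of the action `a` of system `n` under the weights `v`, `q`. -/
def ratio (M : RenewalModel.{u} N L) (v : ℝ) (q : Fin L → ℝ) (n : Fin N) (a : M.A n) : ℝ :=
  v * M.fHat n a + ∑ l, q l * M.gHat n a l

lemma abs_weighted_le {v y Y Z W : ℝ} {q z : Fin L → ℝ} (hy : |y| ≤ Y) (hz : ∀ l, |z l| ≤ Z)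
    (hq : ∀ l, |q l| ≤ W) : |v * y + ∑ l, q l * z l| ≤ |v| * Y + L * (W * Z) := by
  refine (abs_add_le _ _).trans (add_le_add ?_ ?_)
  · rw [abs_mul]
    exact mul_le_mul_of_nonneg_left hy (abs_nonneg _)
  · refine (Finset.abs_sum_le_sum_abs _ _).trans ?_
    have h : ∀ l ∈ (Finset.univ : Finset (Fin L)), |q l * z l| ≤ W * Z := fun l _ => by
      rw [abs_mul]
      exact mul_le_mul (hq l) (hz l) (abs_nonneg _) ((abs_nonneg _).trans (hq l))
    simpa using Finset.sum_le_card_nsmul _ _ _ h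

lemma IsBounded.abs_ratio_le (hb : M.IsBounded ymax zmax dmax B) (v : ℝ) {q : Fin L → ℝ} {W : ℝ}
    (hq : ∀ l, |q l| ≤ W) (n : Fin N) (a : M.A n) :
    |M.ratio v q n a| ≤ |v| * |ymax| + L * (W * |zmax|) :=
  abs_weighted_le (hb.abs_fHat_le n a) (hb.abs_gHat_le n a) hq

namespace Run

variable {Ω : Type v} [mΩ : MeasurableSpace Ω] {P : Measure Ω} (R : M.Run P)

lemma strictMono_renewal (n : Fin N) (ω : Ω) : StrictMono fun k => R.renewal n k ω :=
  strictMono_nat_of_lt_succ fun k => R.renewal_lt n k ω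

/-- The bounds hold almost surely under the law of every action, and the renewal property transfers
the null set Eᶜ to the run on each of the countably many events {t_k = s}. -/
lemma ae_frame_bounded (hb : M.IsBounded ymax zmax dmax B) :
    ∀ᵐ ω ∂P, ∀ n k, ∀ j < (R.frame n k ω).1,
      |((R.frame n k ω).2 j).1| ≤ ymax ∧ ∀ l, |((R.frame n k ω).2 j).2 l| ≤ zmax := by
  set E : Set (Frame L) := {o | ∀ j < o.1, |(o.2 j).1| ≤ ymax ∧ ∀ l, |(o.2 j).2 l| ≤ zmax} with hE
  have hEm : MeasurableSet E := by
    rw [hE, measurableSet_setOfPred]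
    refine Frame.measurable_of_fst fun m => ?_
    refine Measurable.forall fun j => Measurable.imp (p := fun _ => j < m) measurable_const
      (Measurable.and ?_ ?_)
    · rw [← measurableSet_setOfPred]
      exact measurableSet_le (by fun_prop) measurable_const
    · refine Measurable.forall fun l => ?_
      rw [← measurableSet_setOfPred]
      exact measurableSet_le (by fun_prop) measurable_const
  rw [ae_all_iff]; intro n
  rw [ae_all_iff]; intro k
  have key : ∀ s, ∀ᵐ ω ∂P, R.renewal n k ω = s → R.frame n k ω ∈ E := by
    intro s
    have h := R.renewal_property n k s Set.univ Set.univ Eᶜ MeasurableSet.univ MeasurableSet.univ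
      hEm.compl
    rw [setLIntegral_congr_fun (g := fun _ => 0) (by
        simpa using R.measurableSet_renewal_eq n k s) ?_] at h
    · rw [ae_iff]
      rw [lintegral_zero] at h
      refine measure_mono_null (fun ω hω => ?_) h
      simpa [frame] using hω
    · intro ω _
      have h1 := hb.penalty n (R.act n k ω)
      have h2 := hb.metric n (R.act n k ω)
      change M.frameLaw n (R.act n k ω) (Frame.trunc ⁻¹' Eᶜ) = 0
      have h3 : ∀ᵐ o ∂(M.frameLaw n (R.act n k ω)), Frame.trunc o ∈ E := by
        filter_upwards [h1, h2] with o ho1 ho2 j hj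
        have hj' : j < o.1 := hj
        simpa only [Frame.trunc, if_pos hj'] using And.intro (ho1 j hj') (ho2 j hj')
      exact h3
  rw [← ae_all_iff] at key
  filter_upwards [key] with ω hω
  exact hω _ rfl

lemma ae_abs_le (hb : M.IsBounded ymax zmax dmax B) :
    ∀ᵐ ω ∂P, ∀ n t, |R.y n t ω| ≤ |ymax| ∧ ∀ l, |R.z n t ω l| ≤ |zmax| := by
  filter_upwards [R.ae_frame_bounded hb] with ω hω n t
  obtain ⟨K, -, hK⟩ := exists_block_index (R.renewal_zero n ω) (R.strictMono_renewal n ω)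
  obtain ⟨h1, h2⟩ := (hK t (K t)).1 rfl
  have hlt : t - R.renewal n (K t) ω < (R.frame n (K t) ω).1 := by
    change _ < R.renewal n (K t + 1) ω - R.renewal n (K t) ω
    omega
  have h := hω n (K t) (t - R.renewal n (K t) ω) hlt
  have hlt' : t - R.renewal n (K t) ω < R.renewal n (K t + 1) ω - R.renewal n (K t) ω := hlt
  simp only [frame, frameOf, if_pos hlt', Nat.add_sub_of_le h1] at h
  exact ⟨h.1.trans (le_abs_self _), fun l => (h.2 l).trans (le_abs_self _)⟩

lemma ae_abs_ext_le (hb : M.IsBounded ymax zmax dmax B) :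
    ∀ᵐ ω ∂P, ∀ t l, |R.ext t ω l| ≤ |dmax| := by
  rw [ae_all_iff]; intro t
  have h := hb.ext
  rw [← R.ext_law t] at h
  filter_upwards [ae_of_ae_map (R.measurable_ext t).aemeasurable h] with ω hω l
  exact (hω l).trans (le_abs_self _)

/-- The probability is kept on the right because, for m = T - s, these events will turn out to be
disjoint over all frames starting before T. -/
lemma setLIntegral_residual_le [IsFiniteMeasure P] (hb : M.IsBounded ymax zmax dmax B) (n : Fin N)
    (k s m : ℕ) :
    ∫⁻ ω in {ω | R.renewal n k ω = s}, ENNReal.ofReal ((R.duration n k ω - m : ℕ) : ℝ) ∂P ≤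
      ENNReal.ofReal B * P {ω | R.renewal n k ω = s ∧ m ≤ R.duration n k ω} := by
  have hc : Measurable[R.history s] fun _ : Ω => () := @measurable_const _ _ _ (R.history s) _
  have hm : MeasurableSet {o : Frame L | m ≤ o.1} := measurable_fst measurableSet_Ici
  have e1 := R.lintegral_frame n k s hc
    (F := fun x => ENNReal.ofReal ((x.2.1 - m : ℕ) : ℝ))
    ((measurable_from_nat (f := fun i : ℕ => ENNReal.ofReal ((i - m : ℕ) : ℝ))).comp
      (measurable_fst.comp measurable_snd))
  have e2 := R.lintegral_frame n k s hc
    (F := fun x => {o : Frame L | m ≤ o.1}.indicator 1 x.2)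
    ((measurable_one.indicator hm).comp measurable_snd)
  have hd : {ω | R.renewal n k ω = s ∧ m ≤ R.duration n k ω} =
      {ω | m ≤ R.duration n k ω} ∩ {ω | R.renewal n k ω = s} := by
    ext ω
    exact and_comm
  have hdm : MeasurableSet {ω | m ≤ R.duration n k ω} := R.measurable_duration n k measurableSet_Ici
  calc _ = _ := e1
    _ ≤ ∫⁻ ω in {ω | R.renewal n k ω = s}, ENNReal.ofReal B *
          ∫⁻ o, {o : Frame L | m ≤ o.1}.indicator 1 o.trunc ∂(M.frameLaw n (R.act n k ω)) ∂P := by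
        refine lintegral_mono fun ω => (hb.lintegral_residual_le n (R.act n k ω) m).trans_eq ?_
        congr 1
        rw [← lintegral_indicator_one hm]
        rfl
    _ = ENNReal.ofReal B * ∫⁻ ω in {ω | R.renewal n k ω = s},
          ∫⁻ o, {o : Frame L | m ≤ o.1}.indicator 1 o.trunc ∂(M.frameLaw n (R.act n k ω)) ∂P :=
        lintegral_const_mul' _ _ ENNReal.ofReal_ne_top
    _ = _ := by
        rw [← e2, hd, ← Measure.restrict_apply hdm, ← lintegral_indicator_one hdm]
        rfl

lemma setLIntegral_sq_duration_le [IsFiniteMeasure P] (hb : M.IsBounded ymax zmax dmax B)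
    (n : Fin N) (k s : ℕ) :
    ∫⁻ ω in {ω | R.renewal n k ω = s}, ENNReal.ofReal ((R.duration n k ω : ℝ) ^ 2) ∂P ≤
      ENNReal.ofReal B * P {ω | R.renewal n k ω = s} := by
  have hc : Measurable[R.history s] fun _ : Ω => () := @measurable_const _ _ _ (R.history s) _
  have e1 := R.lintegral_frame n k s hc
    (F := fun x => ENNReal.ofReal ((x.2.1 : ℝ) ^ 2))
    ((measurable_from_nat (f := fun i : ℕ => ENNReal.ofReal ((i : ℝ) ^ 2))).comp
      (measurable_fst.comp measurable_snd))
  calc _ = _ := e1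
    _ ≤ ∫⁻ _ in {ω | R.renewal n k ω = s}, ENNReal.ofReal B ∂P :=
        lintegral_mono fun ω => hb.lintegral_sq_le n (R.act n k ω)
    _ = _ := by rw [setLIntegral_const]

end Run

lemma measurable_ratio (M : RenewalModel.{u} N L) (v : ℝ) (n : Fin N) :
    Measurable fun x : (Fin L → ℝ) × M.A n => M.ratio v x.1 n x.2 := by
  have h1 := M.measurable_fHat n
  have h2 := M.measurable_gHat n
  refine ((h1.comp measurable_snd).const_mul v).add (Finset.measurable_fun_sum _ fun l _ => ?_)
  exact ((measurable_pi_apply l).comp measurable_fst).mul ((h2 l).comp measurable_snd)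

/-! ### Scores: zero mean over complete frames, boundary effect at T -/

namespace Run

variable {Ω : Type v} [mΩ : MeasurableSpace Ω] {P : Measure Ω} (R : M.Run P)

/-- The weighted reward of slot `t`, with the weights observed at the start of the `k`-th frame of
system `n`, relative to the ratio that the action of this frame achieves on average. -/
def score (v : ℝ) (q : ℕ → Ω → Fin L → ℝ) (n : Fin N) (k t : ℕ) (ω : Ω) : ℝ :=
  v * R.y n t ω + ∑ l, q (R.renewal n k ω) ω l * R.z n t ω l -
    M.ratio v (q (R.renewal n k ω) ω) n (R.act n k ω)

/-- The total score of the slots before `T` of the `k`-th frame of system `n`. -/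
def blockScore (v : ℝ) (q : ℕ → Ω → Fin L → ℝ) (n : Fin N) (T k : ℕ) (ω : Ω) : ℝ :=
  ∑ t ∈ Finset.range T, if R.renewal n k ω ≤ t ∧ t < R.renewal n (k + 1) ω then
    R.score v q n k t ω else 0

/-- A bound on the slot scores, for weights bounded by `W`. -/
def scoreBound (L : ℕ) (ymax zmax v W : ℝ) : ℝ := 2 * (|v| * |ymax| + L * (W * |zmax|))

lemma scoreBound_nonneg {v W : ℝ} (hW : 0 ≤ W) : 0 ≤ scoreBound L ymax zmax v W := by
  unfold scoreBound; positivity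

variable {v W : ℝ} {q : ℕ → Ω → Fin L → ℝ} {T : ℕ}

lemma totalPenalty_frame (n : Fin N) (k : ℕ) (ω : Ω) : (R.frame n k ω).totalPenalty =
    ∑ t ∈ Finset.Ico (R.renewal n k ω) (R.renewal n (k + 1) ω), R.y n t ω := by
  rw [Finset.sum_Ico_eq_sum_range]
  refine Finset.sum_congr rfl fun j hj => ?_
  have hj' : j < R.renewal n (k + 1) ω - R.renewal n k ω := Finset.mem_range.1 hj
  simp only [frame, frameOf, if_pos hj']

lemma totalMetric_frame (n : Fin N) (k : ℕ) (ω : Ω) (l : Fin L) : (R.frame n k ω).totalMetric l =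
    ∑ t ∈ Finset.Ico (R.renewal n k ω) (R.renewal n (k + 1) ω), R.z n t ω l := by
  rw [Finset.sum_Ico_eq_sum_range]
  refine Finset.sum_congr rfl fun j hj => ?_
  have hj' : j < R.renewal n (k + 1) ω - R.renewal n k ω := Finset.mem_range.1 hj
  simp only [frame, frameOf, if_pos hj']

lemma sum_score (v : ℝ) (q : ℕ → Ω → Fin L → ℝ) (n : Fin N) (k : ℕ) (ω : Ω) :
    ∑ t ∈ Finset.Ico (R.renewal n k ω) (R.renewal n (k + 1) ω), R.score v q n k t ω =
      v * (R.frame n k ω).totalPenalty +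
        ∑ l, q (R.renewal n k ω) ω l * (R.frame n k ω).totalMetric l -
        M.ratio v (q (R.renewal n k ω) ω) n (R.act n k ω) * (R.frame n k ω).1 := by
  simp only [score, totalPenalty_frame, totalMetric_frame, Finset.sum_sub_distrib,
    Finset.sum_add_distrib, Finset.mul_sum, Finset.sum_const, Nat.card_Ico, nsmul_eq_mul]
  rw [Finset.sum_comm, mul_comm (M.ratio v _ _ _)]
  rfl

lemma ae_abs_score_le (hb : M.IsBounded ymax zmax dmax B)
    (hq : ∀ᵐ ω ∂P, ∀ s < T, ∀ l, |q s ω l| ≤ W) :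
    ∀ᵐ ω ∂P, ∀ n k t, R.renewal n k ω < T →
      |R.score v q n k t ω| ≤ scoreBound L ymax zmax v W := by
  filter_upwards [hq, R.ae_abs_le hb] with ω h1 h2 n k t hk
  refine (abs_sub _ _).trans ?_
  rw [scoreBound, two_mul]
  exact add_le_add (abs_weighted_le (h2 n t).1 (h2 n t).2 (h1 _ hk))
    (hb.abs_ratio_le v (h1 _ hk) n _)

lemma integrableOn_duration [IsFiniteMeasure P] (hb : M.IsBounded ymax zmax dmax B) (n : Fin N)
    (k s : ℕ) (m : ℕ) :
    IntegrableOn (fun ω => ((R.duration n k ω - m : ℕ) : ℝ)) {ω | R.renewal n k ω = s} P := by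
  refine ⟨((measurable_from_nat (f := fun i : ℕ => ((i - m : ℕ) : ℝ))).comp
    (R.measurable_duration n k)).aestronglyMeasurable, ?_⟩
  rw [hasFiniteIntegral_iff_ofReal (ae_of_all _ fun o => by positivity)]
  exact (R.setLIntegral_residual_le hb n k s m).trans_lt
    (ENNReal.mul_lt_top ENNReal.ofReal_lt_top (measure_lt_top _ _))

lemma setIntegral_residual_le [IsFiniteMeasure P] (hb : M.IsBounded ymax zmax dmax B) (n : Fin N)
    (k s m : ℕ) :
    ∫ ω in {ω | R.renewal n k ω = s}, ((R.duration n k ω - m : ℕ) : ℝ) ∂P ≤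
      B * P.real {ω | R.renewal n k ω = s ∧ m ≤ R.duration n k ω} := by
  have hB : 0 ≤ B := zero_le_one.trans hb.one_le
  rw [integral_eq_lintegral_of_nonneg_ae (ae_of_all _ fun ω => by positivity)
    (R.integrableOn_duration hb n k s m).1]
  have h := ENNReal.toReal_mono (ENNReal.mul_ne_top ENNReal.ofReal_ne_top (measure_ne_top _ _))
    (R.setLIntegral_residual_le hb n k s m)
  rwa [ENNReal.toReal_mul, ENNReal.toReal_ofReal hB] at h

/-- On {t_k = s} the weights q s are part of the past, so they can be frozen together with the
action. The frame then has mean score zero by `IsBounded.integral_weighted`. -/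
lemma setIntegral_frameScore [IsFiniteMeasure P] (hb : M.IsBounded ymax zmax dmax B)
    (hqm : ∀ s, Measurable[R.history s] (q s)) (hq : ∀ᵐ ω ∂P, ∀ s < T, ∀ l, |q s ω l| ≤ W)
    (n : Fin N) (k : ℕ) {s : ℕ} (hs : s < T) :
    IntegrableOn (fun ω => ∑ t ∈ Finset.Ico (R.renewal n k ω) (R.renewal n (k + 1) ω),
        R.score v q n k t ω) {ω | R.renewal n k ω = s} P ∧
      ∫ ω in {ω | R.renewal n k ω = s},
        ∑ t ∈ Finset.Ico (R.renewal n k ω) (R.renewal n (k + 1) ω), R.score v q n k t ω ∂P = 0 := by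
  set F : ((Fin L → ℝ) × M.A n) × Frame L → ℝ := fun x =>
    v * x.2.totalPenalty + ∑ l, x.1.1 l * x.2.totalMetric l - M.ratio v x.1.1 n x.1.2 * x.2.1 with hF
  have hFm : Measurable F := by
    refine Measurable.sub (((Frame.measurable_totalPenalty.comp measurable_snd).const_mul v).add
      (Finset.measurable_fun_sum _ fun l _ => ?_)) ?_
    · exact ((measurable_pi_apply l).comp (measurable_fst.comp measurable_fst)).mul
        ((Frame.measurable_totalMetric l).comp measurable_snd)
    · exact ((M.measurable_ratio v n).comp measurable_fst).mul
        (measurable_length.comp measurable_snd)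
  have hψ : Measurable (q s) := (hqm s).mono (R.history_le s) le_rfl
  have hms := R.measurableSet_renewal_eq n k s
  have e : Set.EqOn (fun ω => ∑ t ∈ Finset.Ico (R.renewal n k ω) (R.renewal n (k + 1) ω),
      R.score v q n k t ω) (fun ω => F ((q s ω, R.act n k ω), R.frame n k ω))
      {ω | R.renewal n k ω = s} := by
    intro ω hω
    have hω' : R.renewal n k ω = s := hω
    exact (R.sum_score v q n k ω).trans (by simp only [hω', hF])
  have hi : IntegrableOn (fun ω => F ((q s ω, R.act n k ω), R.frame n k ω))
      {ω | R.renewal n k ω = s} P := by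
    refine Integrable.mono' ((R.integrableOn_duration hb n k s 0).const_mul
      (scoreBound L ymax zmax v W)) (hFm.comp ((hψ.prodMk (R.measurable_act n k)).prodMk
        (R.measurable_frame n k))).aestronglyMeasurable ?_
    rw [ae_restrict_iff' hms]
    filter_upwards [R.ae_abs_score_le (v := v) hb hq] with ω h hω
    have e' := e hω
    dsimp only at e'
    rw [← e', Real.norm_eq_abs]
    have hω' : R.renewal n k ω = s := hω
    refine (Finset.abs_sum_le_sum_abs _ _).trans ((Finset.sum_le_card_nsmul _ _ _
      fun t _ => h n k t (hω' ▸ hs)).trans_eq ?_)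
    rw [nsmul_eq_mul, Nat.card_Ico, mul_comm]
    rfl
  refine ⟨hi.congr_fun e.symm hms, ?_⟩
  rw [setIntegral_congr_fun hms e, R.integral_frame n k s (hqm s) hFm hi]
  refine integral_eq_zero_of_ae (ae_of_all _ fun ω => ?_)
  simp only [hF, Frame.totalPenalty_trunc, Frame.totalMetric_trunc, Frame.trunc_fst]
  rw [hb.integral_weighted, ratio, sub_self, zero_mul]
  rfl

lemma measurable_comp_renewal (hqm : ∀ s, Measurable (q s)) (n : Fin N) (k : ℕ) :
    Measurable fun ω => q (R.renewal n k ω) ω := by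
  have h : Measurable fun p : ℕ × Ω => q p.1 p.2 := measurable_from_prod_countable_right hqm
  exact h.comp ((R.measurable_renewal n k).prodMk measurable_id)

lemma measurable_blockScore (hqm : ∀ s, Measurable (q s)) (n : Fin N) (k : ℕ) :
    Measurable (R.blockScore v q n T k) := by
  have hq' := R.measurable_comp_renewal hqm n k
  refine Finset.measurable_fun_sum _ fun t _ => Measurable.ite ?_ ?_ measurable_const
  · exact (R.measurable_renewal n k measurableSet_Iic).inter
      (R.measurable_renewal n (k + 1) measurableSet_Ioi)
  · refine (((R.measurable_y n t).const_mul v).add (Finset.measurable_fun_sum _ fun l _ => ?_)).sub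
      ((M.measurable_ratio v n).comp (hq'.prodMk (R.measurable_act n k)))
    exact ((measurable_pi_apply l).comp hq').mul ((measurable_pi_apply l).comp (R.measurable_z n t))

lemma blockScore_eq_zero {n : Fin N} {k : ℕ} {ω : Ω} (h : T ≤ R.renewal n k ω) :
    R.blockScore v q n T k ω = 0 := by
  refine Finset.sum_eq_zero fun t ht => if_neg ?_
  have := Finset.mem_range.1 ht
  omega

lemma ae_abs_blockScore_le (hb : M.IsBounded ymax zmax dmax B) (hW : 0 ≤ W)
    (hq : ∀ᵐ ω ∂P, ∀ s < T, ∀ l, |q s ω l| ≤ W) :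
    ∀ᵐ ω ∂P, ∀ n k, |R.blockScore v q n T k ω| ≤ T * scoreBound L ymax zmax v W := by
  filter_upwards [R.ae_abs_score_le (v := v) hb hq] with ω h n k
  refine (Finset.abs_sum_le_sum_abs _ _).trans ?_
  have h' : ∀ t ∈ Finset.range T, |(if R.renewal n k ω ≤ t ∧ t < R.renewal n (k + 1) ω then
      R.score v q n k t ω else 0)| ≤ scoreBound L ymax zmax v W := by
    intro t ht
    split_ifs with hc
    · exact h n k t (hc.1.trans_lt (Finset.mem_range.1 ht))
    · simpa using scoreBound_nonneg hW
  simpa using Finset.sum_le_card_nsmul _ _ _ h'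

lemma integrable_blockScore [IsFiniteMeasure P] (hb : M.IsBounded ymax zmax dmax B) (hW : 0 ≤ W)
    (hqm : ∀ s, Measurable (q s)) (hq : ∀ᵐ ω ∂P, ∀ s < T, ∀ l, |q s ω l| ≤ W)
    (n : Fin N) (k : ℕ) : Integrable (R.blockScore v q n T k) P := by
  refine Integrable.of_bound (R.measurable_blockScore hqm n k).aestronglyMeasurable
    (T * scoreBound L ymax zmax v W) ?_
  filter_upwards [R.ae_abs_blockScore_le (v := v) hb hW hq] with ω h
  exact h n k

/-- Subtracting the score of the complete frame, of mean zero, leaves only the slots from T on.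
Their number is the residual lifetime at age T - s, and each costs at most `scoreBound`. -/
lemma abs_setIntegral_blockScore_le [IsFiniteMeasure P] (hb : M.IsBounded ymax zmax dmax B)
    (hW : 0 ≤ W) (hqm : ∀ s, Measurable[R.history s] (q s))
    (hq : ∀ᵐ ω ∂P, ∀ s < T, ∀ l, |q s ω l| ≤ W) (n : Fin N) (k : ℕ) {s : ℕ} (hs : s < T) :
    |∫ ω in {ω | R.renewal n k ω = s}, R.blockScore v q n T k ω ∂P| ≤
      scoreBound L ymax zmax v W *
        (B * P.real {ω | R.renewal n k ω = s ∧ T - s ≤ R.duration n k ω}) := by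
  have hqm' : ∀ s, Measurable (q s) := fun s => (hqm s).mono (R.history_le s) le_rfl
  obtain ⟨hi, h0⟩ := R.setIntegral_frameScore (v := v) hb hqm hq n k hs
  have hib := (R.integrable_blockScore (v := v) hb hW hqm' hq n k).integrableOn
    (s := {ω | R.renewal n k ω = s})
  have hD := scoreBound_nonneg (L := L) (ymax := ymax) (zmax := zmax) (v := v) hW
  rw [← sub_zero (∫ ω in _, R.blockScore v q n T k ω ∂P), ← h0, ← integral_sub hib hi]
  refine abs_integral_le_integral_abs.trans (le_trans ?_
    (mul_le_mul_of_nonneg_left (R.setIntegral_residual_le hb n k s (T - s)) hD))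
  rw [← integral_const_mul]
  refine integral_mono_ae (hib.sub hi).abs ((R.integrableOn_duration hb n k s _).const_mul _) ?_
  rw [EventuallyLE, ae_restrict_iff' (R.measurableSet_renewal_eq n k s)]
  filter_upwards [R.ae_abs_score_le (v := v) hb hq] with ω h hω
  have hω' : R.renewal n k ω = s := hω
  have := abs_sum_block_sub_le (b := R.renewal n (k + 1) ω) (hω' ▸ hs : R.renewal n k ω < T) hD
    fun t => h n k t (hω' ▸ hs)
  simpa only [blockScore, duration, hω'] using this

/-- The expected total score over the slots before `T` is only due to the frames that are incomplete
at time `T`. -/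
theorem abs_integral_sum_blockScore_le [IsProbabilityMeasure P] (hb : M.IsBounded ymax zmax dmax B)
    (hW : 0 ≤ W) (hqm : ∀ s, Measurable[R.history s] (q s))
    (hq : ∀ᵐ ω ∂P, ∀ s < T, ∀ l, |q s ω l| ≤ W) (n : Fin N) :
    |∫ ω, ∑ k ∈ Finset.range T, R.blockScore v q n T k ω ∂P| ≤
      B * scoreBound L ymax zmax v W := by
  have hqm' : ∀ s, Measurable (q s) := fun s => (hqm s).mono (R.history_le s) le_rfl
  have hib := R.integrable_blockScore (v := v) hb hW hqm' hq n
  have hms := R.measurableSet_renewal_eq n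
  have hD := scoreBound_nonneg (L := L) (ymax := ymax) (zmax := zmax) (v := v) hW
  have hB : 0 ≤ B := zero_le_one.trans hb.one_le
  -- The renewal property is available on {t_k = s}, hence the split by start slot; a frame starting
  -- at T or later has block score zero.
  have e1 : ∀ k ω, R.blockScore v q n T k ω = ∑ s ∈ Finset.range T,
      {ω | R.renewal n k ω = s}.indicator (R.blockScore v q n T k) ω := by
    intro k ω
    by_cases h : R.renewal n k ω < T
    · rw [Finset.sum_eq_single_of_mem _ (Finset.mem_range.2 h)]
      · exact (Set.indicator_of_mem (s := {ω' | R.renewal n k ω' = R.renewal n k ω})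
          rfl (R.blockScore v q n T k)).symm
      · intro s _ hs
        exact Set.indicator_of_notMem (s := {ω' | R.renewal n k ω' = s}) (fun h => hs (Eq.symm h)) _
    · rw [R.blockScore_eq_zero (not_lt.1 h)]
      refine (Finset.sum_eq_zero fun s hs => Set.indicator_of_notMem ?_ _).symm
      rintro rfl
      exact h (Finset.mem_range.1 hs)
  have e2 : ∫ ω, ∑ k ∈ Finset.range T, R.blockScore v q n T k ω ∂P =
      ∑ k ∈ Finset.range T, ∑ s ∈ Finset.range T,
        ∫ ω in {ω | R.renewal n k ω = s}, R.blockScore v q n T k ω ∂P := by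
    rw [integral_finsetSum _ fun k _ => hib k]
    refine Finset.sum_congr rfl fun k _ => ?_
    simp_rw [← integral_indicator (hms k _)]
    rw [← integral_finsetSum _ fun s _ => (hib k).indicator (hms k s)]
    exact integral_congr_ae (ae_of_all _ (e1 k))
  set A : ℕ × ℕ → Set Ω := fun p => {ω | R.renewal n p.1 ω = p.2 ∧ T - p.2 ≤ R.duration n p.1 ω}
    with hA
  have hAm : ∀ p, MeasurableSet (A p) := fun p =>
    (hms p.1 p.2).inter (R.measurable_duration n p.1 measurableSet_Ici)
  -- At most one frame starts before T and ends at T or later. The probabilities of the events A p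
  -- thus sum to at most 1, and the bound acquires no factor T.
  have hdisj : Set.PairwiseDisjoint (↑(Finset.range T ×ˢ Finset.range T)) A := by
    have hlt : ∀ p p' : ℕ × ℕ, p.2 < T → p'.2 < T → ∀ ω ∈ A p, ω ∈ A p' → p.1 ≤ p'.1 := by
      intro p p' hp hp' ω h h'
      by_contra hlt
      have h1 : R.renewal n (p'.1 + 1) ω ≤ R.renewal n p.1 ω :=
        (R.strictMono_renewal n ω).monotone (by omega)
      have h2 := h.1
      have h3 := h'.1
      have h4 : T - p'.2 ≤ R.renewal n (p'.1 + 1) ω - R.renewal n p'.1 ω := h'.2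
      omega
    intro p hp p' hp' hne
    simp only [Finset.coe_product, Finset.coe_range, Set.mem_prod, Set.mem_Iio] at hp hp'
    refine Set.disjoint_left.2 fun ω h h' => hne ?_
    have h1 : p.1 = p'.1 := le_antisymm (hlt p p' hp.2 hp'.2 ω h h') (hlt p' p hp'.2 hp.2 ω h' h)
    refine Prod.ext h1 ?_
    rw [← h.1, ← h'.1, h1]
  have hsum : ∑ p ∈ Finset.range T ×ˢ Finset.range T, P.real (A p) ≤ 1 := by
    rw [← measureReal_biUnion_finset hdisj fun p _ => hAm p]
    exact measureReal_le_one
  rw [e2, ← Finset.sum_product']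
  refine (Finset.abs_sum_le_sum_abs _ _).trans ?_
  calc _ ≤ ∑ p ∈ Finset.range T ×ˢ Finset.range T,
        scoreBound L ymax zmax v W * (B * P.real (A p)) := by
        refine Finset.sum_le_sum fun p hp => ?_
        exact R.abs_setIntegral_blockScore_le hb hW hqm hq n p.1
          (Finset.mem_range.1 (Finset.mem_product.1 hp).2)
    _ = scoreBound L ymax zmax v W * (B * ∑ p ∈ Finset.range T ×ˢ Finset.range T, P.real (A p)) := by
        rw [Finset.mul_sum, Finset.mul_sum]
    _ ≤ scoreBound L ymax zmax v W * (B * 1) := by gcongr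
    _ = _ := by ring

end Run

/-! ### The minimal ratio as a function of the weights -/

/-- The smallest ratio that system `n` can achieve under the weights `v`, `q`. -/
def minRatio (M : RenewalModel.{u} N L) (v : ℝ) (q : Fin L → ℝ) (n : Fin N) : ℝ :=
  ⨅ a, M.ratio v q n a

lemma IsBounded.bddBelow_ratio (hb : M.IsBounded ymax zmax dmax B) (v : ℝ) (q : Fin L → ℝ)
    (n : Fin N) : BddBelow (Set.range (M.ratio v q n)) := by
  refine ⟨-(|v| * |ymax| + L * (‖q‖ * |zmax|)), ?_⟩
  rintro _ ⟨a, rfl⟩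
  exact neg_le_of_abs_le (hb.abs_ratio_le v (fun l => norm_le_pi_norm q l) n a)

lemma IsBounded.minRatio_le (hb : M.IsBounded ymax zmax dmax B) (v : ℝ) (q : Fin L → ℝ)
    (n : Fin N) (a : M.A n) : M.minRatio v q n ≤ M.ratio v q n a :=
  ciInf_le (hb.bddBelow_ratio v q n) a

/-- An infimum of functions of q that are uniformly Lipschitz, as |ĝ_l| ≤ |zmax|. This yields
measurability in q, and later the price of using outdated queues. -/
lemma IsBounded.minRatio_le_add (hb : M.IsBounded ymax zmax dmax B) (v : ℝ) (q q' : Fin L → ℝ)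
    (n : Fin N) [Nonempty (M.A n)] :
    M.minRatio v q n ≤ M.minRatio v q' n + |zmax| * ∑ l, |q l - q' l| := by
  rw [← sub_le_iff_le_add]
  refine le_ciInf fun a => ?_
  rw [sub_le_iff_le_add]
  refine (hb.minRatio_le v q n a).trans ?_
  have h : ∑ l, (q l - q' l) * M.gHat n a l ≤ |zmax| * ∑ l, |q l - q' l| := by
    rw [Finset.mul_sum]
    refine Finset.sum_le_sum fun l _ => (le_abs_self _).trans ?_
    rw [abs_mul, mul_comm]
    exact mul_le_mul_of_nonneg_right (hb.abs_gHat_le n a l) (abs_nonneg _)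
  simp only [sub_mul, Finset.sum_sub_distrib] at h
  unfold ratio
  linarith

lemma IsBounded.measurable_minRatio (hb : M.IsBounded ymax zmax dmax B) (v : ℝ) (n : Fin N)
    [Nonempty (M.A n)] : Measurable fun q => M.minRatio v q n := by
  have h : LipschitzWith (Real.toNNReal (|zmax| * L)) fun q => M.minRatio v q n := by
    refine LipschitzWith.of_le_add_mul _ fun q q' => (hb.minRatio_le_add v q q' n).trans ?_
    rw [Real.coe_toNNReal _ (by positivity), mul_assoc]
    refine add_le_add le_rfl (mul_le_mul_of_nonneg_left ?_ (abs_nonneg _))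
    simpa [Real.dist_eq] using Finset.sum_le_card_nsmul Finset.univ _ (dist q q') fun l _ => dist_le_pi_dist q q' l
  exact h.continuous.measurable

lemma IsBounded.abs_minRatio_le (hb : M.IsBounded ymax zmax dmax B) (v : ℝ) {q : Fin L → ℝ}
    {W : ℝ} (hq : ∀ l, |q l| ≤ W) (n : Fin N) [Nonempty (M.A n)] :
    |M.minRatio v q n| ≤ |v| * |ymax| + L * (W * |zmax|) := by
  obtain ⟨a⟩ := ‹Nonempty (M.A n)›
  refine abs_le.2 ⟨le_ciInf fun a => neg_le_of_abs_le (hb.abs_ratio_le v hq n a), ?_⟩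
  exact (hb.minRatio_le v q n a).trans (le_of_abs_le (hb.abs_ratio_le v hq n a))

/-! ### Lower bound for arbitrary runs under constant weights -/

namespace Run

variable {Ω : Type v} [mΩ : MeasurableSpace Ω] {P : Measure Ω} (R : M.Run P)
  {v W : ℝ} {q : ℕ → Ω → Fin L → ℝ} {T : ℕ}

lemma integrable_y [IsFiniteMeasure P] (hb : M.IsBounded ymax zmax dmax B) (n : Fin N) (t : ℕ) :
    Integrable (R.y n t) P := by
  refine Integrable.of_bound (R.measurable_y n t).aestronglyMeasurable |ymax| ?_
  filter_upwards [R.ae_abs_le hb] with ω h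
  exact (h n t).1

lemma measurable_z_apply (n : Fin N) (t : ℕ) (l : Fin L) : Measurable fun ω => R.z n t ω l :=
  (measurable_pi_apply l).comp (R.measurable_z n t)

lemma integrable_z [IsFiniteMeasure P] (hb : M.IsBounded ymax zmax dmax B) (n : Fin N) (t : ℕ)
    (l : Fin L) : Integrable (fun ω => R.z n t ω l) P := by
  refine Integrable.of_bound (R.measurable_z_apply n t l).aestronglyMeasurable |zmax| ?_
  filter_upwards [R.ae_abs_le hb] with ω h
  exact (h n t).2 l

/-- Under constant weights, no run can perform better than the best ratio, up to a constant. -/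
theorem le_sum_integral [IsProbabilityMeasure P] (hb : M.IsBounded ymax zmax dmax B)
    {w : Fin L → ℝ} (hW : 0 ≤ W) (hw : ∀ l, |w l| ≤ W) (n : Fin N) {m : ℝ}
    (hm : ∀ a, m ≤ M.ratio v w n a) (T : ℕ) :
    T * m - B * scoreBound L ymax zmax v W ≤ v * ∑ t ∈ Finset.range T, ∫ ω, R.y n t ω ∂P +
      ∑ l, w l * ∑ t ∈ Finset.range T, ∫ ω, R.z n t ω l ∂P := by
  have hqm : ∀ s, Measurable[R.history s] fun _ : Ω => w := fun s =>
    @measurable_const _ _ _ (R.history s) _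
  have hq : ∀ᵐ _ ∂P, ∀ s < T, ∀ l, |w l| ≤ W := ae_of_all _ fun _ _ _ => hw
  have hU := R.abs_integral_sum_blockScore_le (v := v) (q := fun _ _ => w) hb hW hqm hq n
  have hz : ∀ t, Integrable (fun ω => ∑ l, w l * R.z n t ω l) P := fun t =>
    integrable_finsetSum _ fun l _ => (R.integrable_z hb n t l).const_mul _
  have hyz : ∀ t, Integrable (fun ω => v * R.y n t ω + ∑ l, w l * R.z n t ω l) P := fun t =>
    ((R.integrable_y hb n t).const_mul v).add (hz t)
  have hp : ∀ t, Integrable (fun ω => v * R.y n t ω + ∑ l, w l * R.z n t ω l - m) P := fun t =>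
    (hyz t).sub (integrable_const m)
  -- Every action has ratio at least m, so each score is at most the deviation from m; the blocks
  -- then reassemble into the slots before T.
  have hle : ∫ ω, ∑ k ∈ Finset.range T, R.blockScore v (fun _ _ => w) n T k ω ∂P ≤
      ∫ ω, ∑ t ∈ Finset.range T, (v * R.y n t ω + ∑ l, w l * R.z n t ω l - m) ∂P := by
    refine integral_mono (integrable_finsetSum _ fun k _ => R.integrable_blockScore hb hW
      (fun s => (hqm s).mono (R.history_le s) le_rfl) hq n k)
      (integrable_finsetSum _ fun t _ => hp t) fun ω => ?_
    dsimp only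
    rw [← sum_blocks (R.renewal_zero n ω) (R.strictMono_renewal n ω) T fun t =>
      v * R.y n t ω + ∑ l, w l * R.z n t ω l - m]
    refine Finset.sum_le_sum fun k _ => Finset.sum_le_sum fun t _ => ?_
    split_ifs
    · exact sub_le_sub_left (hm _) _
    · exact le_rfl
  have he : ∫ ω, ∑ t ∈ Finset.range T, (v * R.y n t ω + ∑ l, w l * R.z n t ω l - m) ∂P =
      v * ∑ t ∈ Finset.range T, ∫ ω, R.y n t ω ∂P +
      ∑ l, w l * ∑ t ∈ Finset.range T, ∫ ω, R.z n t ω l ∂P - T * m := by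
    rw [integral_finsetSum _ fun t _ => hp t]
    have h1 : ∀ t, ∫ ω, (v * R.y n t ω + ∑ l, w l * R.z n t ω l - m) ∂P =
        v * ∫ ω, R.y n t ω ∂P + ∑ l, w l * ∫ ω, R.z n t ω l ∂P - m := fun t => by
      rw [integral_sub (hyz t) (integrable_const m),
        integral_add ((R.integrable_y hb n t).const_mul v) (hz t), integral_const_mul,
        integral_finsetSum _ fun l _ => (R.integrable_z hb n t l).const_mul _]
      simp [integral_const_mul]
    simp_rw [h1, Finset.sum_sub_distrib, Finset.sum_add_distrib, Finset.mul_sum]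
    rw [Finset.sum_comm (s := Finset.range T)]
    simp
  have := neg_le_of_abs_le hU
  linarith

/-! ### Growth and integrability of the virtual queues -/

lemma Q_succ (ω : Ω) (t : ℕ) (l : Fin L) :
    R.Q ω (t + 1) l = max (R.Q ω t l + ∑ n, R.z n t ω l - R.ext t ω l) 0 := rfl

lemma Q_nonneg (ω : Ω) (t : ℕ) (l : Fin L) : 0 ≤ R.Q ω t l := by
  cases t with
  | zero => exact le_rfl
  | succ t => exact le_max_right _ _

/-- A bound on the change of a virtual queue in one slot. -/
def queueStep (N : ℕ) (zmax dmax : ℝ) : ℝ := N * |zmax| + |dmax|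

lemma queueStep_nonneg : 0 ≤ queueStep N zmax dmax := by
  unfold queueStep; positivity

lemma ae_abs_increment_le (hb : M.IsBounded ymax zmax dmax B) :
    ∀ᵐ ω ∂P, ∀ t l, |∑ n, R.z n t ω l - R.ext t ω l| ≤ queueStep N zmax dmax := by
  filter_upwards [R.ae_abs_le hb, R.ae_abs_ext_le hb] with ω h1 h2 t l
  refine (abs_sub _ _).trans (add_le_add ?_ (h2 t l))
  refine (Finset.abs_sum_le_sum_abs _ _).trans ?_
  simpa using Finset.sum_le_card_nsmul Finset.univ _ _ fun n _ => (h1 n t).2 l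

/-- Truncation at 0 does not enlarge a step, because the queue was already nonnegative. -/
lemma ae_abs_Q_sub_le (hb : M.IsBounded ymax zmax dmax B) :
    ∀ᵐ ω ∂P, ∀ s i l, |R.Q ω (s + i) l - R.Q ω s l| ≤ queueStep N zmax dmax * i := by
  filter_upwards [R.ae_abs_increment_le hb] with ω h s i l
  induction i with
  | zero => simp
  | succ i ih =>
    have h1 := abs_le.1 (h (s + i) l)
    have h0 := R.Q_nonneg ω (s + i) l
    have h2 : |R.Q ω (s + (i + 1)) l - R.Q ω (s + i) l| ≤ queueStep N zmax dmax := by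
      rw [← add_assoc, Q_succ, abs_le]
      constructor
      · have := le_max_left (R.Q ω (s + i) l + ∑ n, R.z n (s + i) ω l - R.ext (s + i) ω l) 0
        linarith
      · rw [sub_le_iff_le_add]
        exact max_le (by linarith) (by linarith)
    have h3 := abs_sub_le (R.Q ω (s + (i + 1)) l) (R.Q ω (s + i) l) (R.Q ω s l)
    push_cast
    linarith

lemma ae_Q_le (hb : M.IsBounded ymax zmax dmax B) (T : ℕ) :
    ∀ᵐ ω ∂P, ∀ s ≤ T, ∀ l, |R.Q ω s l| ≤ queueStep N zmax dmax * T := by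
  filter_upwards [R.ae_abs_Q_sub_le hb] with ω h s hs l
  have h1 := h 0 s l
  rw [zero_add, show R.Q ω 0 l = 0 from rfl, sub_zero] at h1
  exact h1.trans (mul_le_mul_of_nonneg_left (by exact_mod_cast hs) queueStep_nonneg)

lemma measurable_Q_apply (t : ℕ) (l : Fin L) : Measurable fun ω => R.Q ω t l :=
  (measurable_pi_apply l).comp (R.measurable_Q t)

lemma integrable_Q [IsFiniteMeasure P] (hb : M.IsBounded ymax zmax dmax B) (t : ℕ) (l : Fin L) :
    Integrable (fun ω => R.Q ω t l) P := by
  refine Integrable.of_bound (R.measurable_Q_apply t l).aestronglyMeasurable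
    (queueStep N zmax dmax * t) ?_
  filter_upwards [R.ae_Q_le hb t] with ω h
  exact h t le_rfl l

lemma integrable_Q_mul_z [IsFiniteMeasure P] (hb : M.IsBounded ymax zmax dmax B) (n : Fin N)
    (t : ℕ) (l : Fin L) : Integrable (fun ω => R.Q ω t l * R.z n t ω l) P := by
  refine (R.integrable_z hb n t l).bdd_mul (c := queueStep N zmax dmax * t)
    (R.measurable_Q_apply t l).aestronglyMeasurable ?_
  filter_upwards [R.ae_Q_le hb t] with ω h
  exact h t le_rfl l

lemma nonempty_act [IsProbabilityMeasure P] (R : M.Run P) (n : Fin N) : Nonempty (M.A n) := by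
  obtain ⟨ω⟩ := nonempty_of_isProbabilityMeasure P
  exact ⟨R.act n 0 ω⟩

lemma integrable_minRatio_Q [IsProbabilityMeasure P] (hb : M.IsBounded ymax zmax dmax B) (v : ℝ)
    (n : Fin N) (t : ℕ) : Integrable (fun ω => M.minRatio v (R.Q ω t) n) P := by
  have := R.nonempty_act n
  refine Integrable.of_bound
    ((hb.measurable_minRatio v n).comp (R.measurable_Q t)).aestronglyMeasurable
    (|v| * |ymax| + L * (queueStep N zmax dmax * t * |zmax|)) ?_
  filter_upwards [R.ae_Q_le hb t] with ω h
  exact hb.abs_minRatio_le v (h t le_rfl) n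

/-! ### The algorithm: cost of observing the queues only at renewals -/

/-- The square of the duration of the `k`-th frame of system `n`, if it starts before `T`. -/
def sqDuration (n : Fin N) (T k : ℕ) (ω : Ω) : ℝ :=
  ∑ s ∈ Finset.range T, {ω | R.renewal n k ω = s}.indicator (fun ω => (R.duration n k ω : ℝ) ^ 2) ω

lemma sqDuration_nonneg (n : Fin N) (T k : ℕ) (ω : Ω) : 0 ≤ R.sqDuration n T k ω :=
  Finset.sum_nonneg fun _ _ => Set.indicator_nonneg (fun _ _ => sq_nonneg _) _

lemma sqDuration_eq {n : Fin N} {k : ℕ} {ω : Ω} (h : R.renewal n k ω < T) :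
    R.sqDuration n T k ω = (R.duration n k ω : ℝ) ^ 2 := by
  rw [sqDuration, Finset.sum_eq_single_of_mem _ (Finset.mem_range.2 h)]
  · exact Set.indicator_of_mem (s := {ω' | R.renewal n k ω' = R.renewal n k ω}) rfl
      (fun ω => (R.duration n k ω : ℝ) ^ 2)
  · intro s _ hs
    exact Set.indicator_of_notMem (s := {ω' | R.renewal n k ω' = s}) (fun h => hs (Eq.symm h)) _

lemma integrableOn_sq_duration [IsFiniteMeasure P] (hb : M.IsBounded ymax zmax dmax B) (n : Fin N)
    (k s : ℕ) :
    IntegrableOn (fun ω => (R.duration n k ω : ℝ) ^ 2) {ω | R.renewal n k ω = s} P := by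
  refine ⟨((measurable_from_nat (f := fun i : ℕ => (i : ℝ) ^ 2)).comp
    (R.measurable_duration n k)).aestronglyMeasurable, ?_⟩
  rw [hasFiniteIntegral_iff_ofReal (ae_of_all _ fun o => by positivity)]
  exact (R.setLIntegral_sq_duration_le hb n k s).trans_lt
    (ENNReal.mul_lt_top ENNReal.ofReal_lt_top (measure_lt_top _ _))

lemma integrable_sqDuration [IsFiniteMeasure P] (hb : M.IsBounded ymax zmax dmax B) (n : Fin N)
    (T k : ℕ) : Integrable (R.sqDuration n T k) P :=
  integrable_finsetSum _ fun s _ =>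
    (R.integrableOn_sq_duration hb n k s).integrable_indicator (R.measurableSet_renewal_eq n k s)

/-- A slot is the start of at most one frame of the system, so each of the T slots accounts for at
most B. -/
lemma integral_sum_sqDuration_le [IsProbabilityMeasure P] (hb : M.IsBounded ymax zmax dmax B)
    (n : Fin N) (T : ℕ) : ∫ ω, ∑ k ∈ Finset.range T, R.sqDuration n T k ω ∂P ≤ B * T := by
  have hB : 0 ≤ B := zero_le_one.trans hb.one_le
  have hms := R.measurableSet_renewal_eq n
  have h1 : ∀ k s, ∫ ω in {ω | R.renewal n k ω = s}, (R.duration n k ω : ℝ) ^ 2 ∂P ≤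
      B * P.real {ω | R.renewal n k ω = s} := by
    intro k s
    rw [integral_eq_lintegral_of_nonneg_ae (ae_of_all _ fun ω => by positivity)
      (R.integrableOn_sq_duration hb n k s).1]
    have h := ENNReal.toReal_mono (ENNReal.mul_ne_top ENNReal.ofReal_ne_top (measure_ne_top _ _))
      (R.setLIntegral_sq_duration_le hb n k s)
    rwa [ENNReal.toReal_mul, ENNReal.toReal_ofReal hB] at h
  have h2 : ∀ s, ∑ k ∈ Finset.range T, P.real {ω | R.renewal n k ω = s} ≤ 1 := by
    intro s
    rw [← measureReal_biUnion_finset _ fun k _ => hms k s]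
    · exact measureReal_le_one
    · intro k _ k' _ hne
      refine Set.disjoint_left.2 fun ω h h' => hne ((R.strictMono_renewal n ω).injective ?_)
      exact h.trans (Eq.symm h')
  rw [integral_finsetSum _ fun k _ => R.integrable_sqDuration hb n T k]
  calc _ = ∑ k ∈ Finset.range T, ∑ s ∈ Finset.range T,
        ∫ ω in {ω | R.renewal n k ω = s}, (R.duration n k ω : ℝ) ^ 2 ∂P := by
        refine Finset.sum_congr rfl fun k _ => ?_
        simp_rw [← integral_indicator (hms k _)]
        exact integral_finsetSum _ fun s _ =>
          (R.integrableOn_sq_duration hb n k s).integrable_indicator (hms k s)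
    _ ≤ ∑ k ∈ Finset.range T, ∑ s ∈ Finset.range T, B * P.real {ω | R.renewal n k ω = s} :=
        Finset.sum_le_sum fun k _ => Finset.sum_le_sum fun s _ => h1 k s
    _ = B * ∑ s ∈ Finset.range T, ∑ k ∈ Finset.range T, P.real {ω | R.renewal n k ω = s} := by
        rw [Finset.sum_comm]
        simp_rw [Finset.mul_sum]
    _ ≤ B * ∑ s ∈ Finset.range T, 1 := by
        gcongr with s
        exact h2 s
    _ = B * T := by simp

lemma FollowsAlgorithm.ae_ratio_le [IsProbabilityMeasure P] {R : M.Run P} {V : ℝ}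
    (hR : R.FollowsAlgorithm V) (hb : M.IsBounded ymax zmax dmax B) :
    ∀ᵐ ω ∂P, ∀ n k, M.ratio V (R.Q ω (R.renewal n k ω)) n (R.act n k ω) ≤
      M.minRatio V (R.Q ω (R.renewal n k ω)) n := by
  filter_upwards [hR] with ω h n k
  have := R.nonempty_act n
  refine le_ciInf fun a => ?_
  have := h n k a
  rwa [hb.dppRatio_eq, hb.dppRatio_eq] at this

/-- Under the algorithm, the expected drift-plus-penalty of each system is close to the smallest
possible one. -/
theorem FollowsAlgorithm.integral_sum_sub_minRatio_le [IsProbabilityMeasure P] {R : M.Run P} {V : ℝ}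
    (hR : R.FollowsAlgorithm V) (hb : M.IsBounded ymax zmax dmax B) (n : Fin N) (T : ℕ) :
    ∑ t ∈ Finset.range T, (V * ∫ ω, R.y n t ω ∂P + ∑ l, ∫ ω, R.Q ω t l * R.z n t ω l ∂P -
        ∫ ω, M.minRatio V (R.Q ω t) n ∂P) ≤
      B * scoreBound L ymax zmax V (queueStep N zmax dmax * T) +
        2 * |zmax| * L * queueStep N zmax dmax * (B * T) := by
  have := R.nonempty_act n
  set δ := queueStep N zmax dmax with hδ
  have hδ0 : 0 ≤ δ := queueStep_nonneg
  set q : ℕ → Ω → Fin L → ℝ := fun s ω => R.Q ω s with hqdef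
  have hW : 0 ≤ δ * T := by positivity
  have hqm : ∀ s, Measurable[R.history s] (q s) := fun s => R.measurable_history_Q le_rfl
  have hq : ∀ᵐ ω ∂P, ∀ s < T, ∀ l, |q s ω l| ≤ δ * T := by
    filter_upwards [R.ae_Q_le hb T] with ω h s hs
    exact h s hs.le
  have hU := R.abs_integral_sum_blockScore_le (v := V) hb hW hqm hq n
  have hS := R.integral_sum_sqDuration_le hb n T
  have hiS : Integrable (fun ω => ∑ k ∈ Finset.range T, R.blockScore V q n T k ω) P :=
    integrable_finsetSum _ fun k _ => R.integrable_blockScore hb hW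
      (fun s => (hqm s).mono (R.history_le s) le_rfl) hq n k
  have hiD : Integrable (fun ω => ∑ k ∈ Finset.range T, R.sqDuration n T k ω) P :=
    integrable_finsetSum _ fun k _ => R.integrable_sqDuration hb n T k
  -- The factor 2: Q[t] is exchanged with Q[t_k] once in ⟨Q, z⟩ and once in `minRatio`, each time at
  -- a cost of at most |zmax| · L · δ · duration.
  set c := 2 * |zmax| * L * δ with hc
  have hc0 : 0 ≤ c := by positivity
  have hz : ∀ t, Integrable (fun ω => ∑ l, R.Q ω t l * R.z n t ω l) P := fun t =>
    integrable_finsetSum _ fun l _ => R.integrable_Q_mul_z hb n t l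
  have hyz : ∀ t, Integrable (fun ω => V * R.y n t ω + ∑ l, R.Q ω t l * R.z n t ω l) P := fun t =>
    ((R.integrable_y hb n t).const_mul V).add (hz t)
  have hp : ∀ t, Integrable (fun ω => V * R.y n t ω + ∑ l, R.Q ω t l * R.z n t ω l -
      M.minRatio V (R.Q ω t) n) P := fun t => (hyz t).sub (R.integrable_minRatio_Q hb V n t)
  have hle : ∫ ω, ∑ t ∈ Finset.range T, (V * R.y n t ω + ∑ l, R.Q ω t l * R.z n t ω l -
      M.minRatio V (R.Q ω t) n) ∂P ≤ ∫ ω, (∑ k ∈ Finset.range T, R.blockScore V q n T k ω +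
        c * ∑ k ∈ Finset.range T, R.sqDuration n T k ω) ∂P := by
    refine integral_mono_ae (integrable_finsetSum _ fun t _ => hp t)
      (hiS.add (hiD.const_mul c)) ?_
    filter_upwards [hR.ae_ratio_le hb, R.ae_abs_Q_sub_le hb, R.ae_abs_le hb] with ω h1 h2 h3
    rw [← sum_blocks (R.renewal_zero n ω) (R.strictMono_renewal n ω) T fun t =>
      V * R.y n t ω + ∑ l, R.Q ω t l * R.z n t ω l - M.minRatio V (R.Q ω t) n, Finset.mul_sum,
      ← Finset.sum_add_distrib]
    refine Finset.sum_le_sum fun k _ => ?_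
    by_cases hk : R.renewal n k ω < T
    swap
    · refine le_trans (Finset.sum_nonpos fun t ht => ?_) (add_nonneg
        (R.blockScore_eq_zero (not_lt.1 hk)).ge (mul_nonneg hc0 (R.sqDuration_nonneg n T k ω)))
      have := Finset.mem_range.1 ht
      rw [if_neg (by omega)]
    rw [R.sqDuration_eq hk, blockScore, ← Finset.sum_filter, ← Finset.sum_filter,
      ← sub_le_iff_le_add', ← Finset.sum_sub_distrib]
    -- An error of c · duration in each slot, over at most `duration` slots, gives c · duration² for
    -- the frame.
    have hterm : ∀ t ∈ (Finset.range T).filter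
        (fun t => R.renewal n k ω ≤ t ∧ t < R.renewal n (k + 1) ω),
        V * R.y n t ω + ∑ l, R.Q ω t l * R.z n t ω l - M.minRatio V (R.Q ω t) n -
          R.score V q n k t ω ≤ c * R.duration n k ω := by
      intro t ht
      obtain ⟨ht1, ht2⟩ := (Finset.mem_filter.1 ht).2
      have hQ : ∀ l, |R.Q ω t l - R.Q ω (R.renewal n k ω) l| ≤ δ * R.duration n k ω := by
        intro l
        have h := h2 (R.renewal n k ω) (t - R.renewal n k ω) l
        rw [Nat.add_sub_of_le ht1] at h
        refine h.trans (mul_le_mul_of_nonneg_left ?_ hδ0)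
        have : t - R.renewal n k ω ≤ R.duration n k ω := by unfold duration; omega
        exact_mod_cast this
      have hQs : ∑ l, |R.Q ω t l - R.Q ω (R.renewal n k ω) l| ≤ L * (δ * R.duration n k ω) := by
        simpa using Finset.sum_le_card_nsmul Finset.univ _ _ fun l _ => hQ l
      have ha : ∑ l, (R.Q ω t l - R.Q ω (R.renewal n k ω) l) * R.z n t ω l ≤
          |zmax| * ∑ l, |R.Q ω t l - R.Q ω (R.renewal n k ω) l| := by
        rw [Finset.mul_sum]
        refine Finset.sum_le_sum fun l _ => (le_abs_self _).trans ?_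
        rw [abs_mul, mul_comm]
        exact mul_le_mul_of_nonneg_right ((h3 n t).2 l) (abs_nonneg _)
      simp only [sub_mul, Finset.sum_sub_distrib] at ha
      have hb1 := hb.minRatio_le_add V (R.Q ω (R.renewal n k ω)) (R.Q ω t) n
      simp_rw [abs_sub_comm (R.Q ω (R.renewal n k ω) _)] at hb1
      have hb2 := h1 n k
      have hmul := mul_le_mul_of_nonneg_left hQs (abs_nonneg zmax)
      simp only [score, hqdef, hc]
      linarith
    refine (Finset.sum_le_card_nsmul _ _ _ hterm).trans ?_
    have hcard : ((Finset.range T).filter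
        (fun t => R.renewal n k ω ≤ t ∧ t < R.renewal n (k + 1) ω)).card ≤ R.duration n k ω := by
      rw [duration, ← Nat.card_Ico]
      refine Finset.card_le_card fun t ht => ?_
      exact Finset.mem_Ico.2 (Finset.mem_filter.1 ht).2
    rw [nsmul_eq_mul]
    exact (mul_le_mul_of_nonneg_right (Nat.cast_le.2 hcard) (by positivity)).trans_eq (by ring)
  rw [integral_finsetSum _ fun t _ => hp t, integral_add hiS (hiD.const_mul c),
    integral_const_mul] at hle
  have h1 : ∀ t, ∫ ω, (V * R.y n t ω + ∑ l, R.Q ω t l * R.z n t ω l -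
      M.minRatio V (R.Q ω t) n) ∂P = V * ∫ ω, R.y n t ω ∂P + ∑ l, ∫ ω, R.Q ω t l * R.z n t ω l ∂P -
        ∫ ω, M.minRatio V (R.Q ω t) n ∂P := fun t => by
    rw [integral_sub (hyz t) (R.integrable_minRatio_Q hb V n t),
      integral_add ((R.integrable_y hb n t).const_mul V) (hz t), integral_const_mul,
      integral_finsetSum _ fun l _ => R.integrable_Q_mul_z hb n t l]
  simp_rw [h1] at hle
  have h4 := le_of_abs_le hU
  have h5 := mul_le_mul_of_nonneg_left hS hc0
  linarith

end Run

/-! ### Time averages and comparison with the optimal value -/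

namespace Run

variable {Ω : Type v} [mΩ : MeasurableSpace Ω] {P : Measure Ω} (R : M.Run P)

lemma mul_avgPenalty (T : ℕ) :
    T * R.avgPenalty T = ∑ n, ∑ t ∈ Finset.range T, ∫ ω, R.y n t ω ∂P := by
  rw [avgPenalty, Finset.sum_comm]
  rcases T.eq_zero_or_pos with rfl | hT
  · simp
  · have : (T : ℝ) ≠ 0 := by positivity
    field_simp

lemma mul_avgMetric (l : Fin L) (T : ℕ) :
    T * R.avgMetric l T = ∑ n, ∑ t ∈ Finset.range T, ∫ ω, R.z n t ω l ∂P := by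
  rw [avgMetric, Finset.sum_comm]
  rcases T.eq_zero_or_pos with rfl | hT
  · simp
  · have : (T : ℝ) ≠ 0 := by positivity
    field_simp

lemma abs_average_le {f : Fin N → ℕ → ℝ} {K : ℝ} (hK : 0 ≤ K) (hf : ∀ n t, |f n t| ≤ K) (T : ℕ) :
    |(1 / (T : ℝ)) * ∑ t ∈ Finset.range T, ∑ n, f n t| ≤ N * K := by
  rcases T.eq_zero_or_pos with rfl | hT
  · simp only [Finset.range_zero, Finset.sum_empty, mul_zero, abs_zero]
    positivity
  have hT' : (0 : ℝ) < T := by positivity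
  have h : |∑ t ∈ Finset.range T, ∑ n, f n t| ≤ T * (N * K) := by
    refine (Finset.abs_sum_le_sum_abs _ _).trans ?_
    have h1 : ∀ t ∈ Finset.range T, |∑ n, f n t| ≤ N * K := fun t _ => by
      refine (Finset.abs_sum_le_sum_abs _ _).trans ?_
      simpa using Finset.sum_le_card_nsmul Finset.univ _ _ fun n _ => hf n t
    simpa using Finset.sum_le_card_nsmul _ _ _ h1
  rw [abs_mul, abs_of_pos (by positivity), one_div, inv_mul_le_iff₀ hT']
  exact h

lemma abs_integral_le [IsProbabilityMeasure P] {f : Ω → ℝ} {K : ℝ} (h : ∀ᵐ ω ∂P, |f ω| ≤ K) :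
    |∫ ω, f ω ∂P| ≤ K := by
  simpa using norm_integral_le_of_norm_le_const (μ := P) (f := f) h

lemma isBoundedUnder_avgPenalty [IsProbabilityMeasure P] (hb : M.IsBounded ymax zmax dmax B) :
    IsBoundedUnder (· ≤ ·) atTop R.avgPenalty := by
  refine isBoundedUnder_of ⟨N * |ymax|, fun T => le_of_abs_le ?_⟩
  refine abs_average_le (abs_nonneg _) (fun n t => abs_integral_le ?_) T
  filter_upwards [R.ae_abs_le hb] with ω h
  exact (h n t).1

lemma isBoundedUnder_avgMetric [IsProbabilityMeasure P] (hb : M.IsBounded ymax zmax dmax B)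
    (l : Fin L) : IsBoundedUnder (· ≤ ·) atTop (R.avgMetric l) := by
  refine isBoundedUnder_of ⟨N * |zmax|, fun T => le_of_abs_le ?_⟩
  refine abs_average_le (abs_nonneg _) (fun n t => abs_integral_le ?_) T
  filter_upwards [R.ae_abs_le hb] with ω h
  exact (h n t).2 l

lemma le_mul_avg [IsProbabilityMeasure P] (hb : M.IsBounded ymax zmax dmax B) (v : ℝ)
    {w : Fin L → ℝ} {W : ℝ} (hW : 0 ≤ W) (hw : ∀ l, |w l| ≤ W) (T : ℕ) :
    T * ∑ n, M.minRatio v w n - N * (B * scoreBound L ymax zmax v W) ≤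
      T * (v * R.avgPenalty T + ∑ l, w l * R.avgMetric l T) := by
  have h := Finset.sum_le_sum fun n (_ : n ∈ Finset.univ) =>
    R.le_sum_integral (v := v) hb hW hw n (fun a => hb.minRatio_le v w n a) T
  have e : (T : ℝ) * (v * R.avgPenalty T + ∑ l, w l * R.avgMetric l T) =
      v * (T * R.avgPenalty T) + ∑ l, w l * (T * R.avgMetric l T) := by
    rw [mul_add, Finset.mul_sum]
    congr 1
    · ring
    · exact Finset.sum_congr rfl fun l _ => by ring
  rw [e, mul_avgPenalty]
  simp_rw [mul_avgMetric]
  simp only [Finset.sum_sub_distrib, Finset.sum_add_distrib, Finset.sum_const, Finset.card_univ,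
    Fintype.card_fin, nsmul_eq_mul, ← Finset.mul_sum] at h
  exact h.trans_eq (congrArg _ (Finset.sum_comm.trans
    (Finset.sum_congr rfl fun l _ => (Finset.mul_sum _ _ _).symm)))

/-- The bound `le_mul_avg` divided by T: its boundary term vanishes as T → ∞, while the averages are
eventually below their limsup plus η. Nonnegative weights preserve these inequalities. -/
lemma sum_minRatio_le_limsup [IsProbabilityMeasure P] (hb : M.IsBounded ymax zmax dmax B)
    (hR : R.MeetsConstraints) {V : ℝ} (hV : 0 ≤ V) {q : Fin L → ℝ} (hq : ∀ l, 0 ≤ q l) :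
    ∑ n, M.minRatio V q n ≤ V * limsup R.avgPenalty atTop + ∑ l, q l * M.d l := by
  set x := limsup R.avgPenalty atTop with hx
  set D := N * (B * scoreBound L ymax zmax V ‖q‖) with hD
  set S := V + ∑ l, q l with hS
  have hS0 : 0 ≤ S := add_nonneg hV (Finset.sum_nonneg fun l _ => hq l)
  have key : ∀ η > 0, ∑ n, M.minRatio V q n ≤ V * x + ∑ l, q l * M.d l + η * S := by
    intro η hη
    have h1 : ∀ᶠ T in atTop, R.avgPenalty T < x + η :=
      eventually_lt_of_limsup_lt (by linarith) (R.isBoundedUnder_avgPenalty hb)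
    have h2 : ∀ᶠ T in atTop, ∀ l, R.avgMetric l T < M.d l + η := by
      rw [eventually_all]
      exact fun l => eventually_lt_of_limsup_lt (by linarith [hR l])
        (R.isBoundedUnder_avgMetric hb l)
    have h3 : ∀ᶠ T : ℕ in atTop, ∑ n, M.minRatio V q n ≤
        V * x + ∑ l, q l * M.d l + η * S + D * (T : ℝ)⁻¹ := by
      filter_upwards [h1, h2, eventually_gt_atTop 0] with T hT1 hT2 hT
      have hT0 : (0 : ℝ) < T := by exact_mod_cast hT
      have h := R.le_mul_avg hb V (norm_nonneg q) (fun l => norm_le_pi_norm q l) T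
      have h4 : V * R.avgPenalty T ≤ V * (x + η) := mul_le_mul_of_nonneg_left hT1.le hV
      have h5 : ∑ l, q l * R.avgMetric l T ≤ ∑ l, q l * (M.d l + η) :=
        Finset.sum_le_sum fun l _ => mul_le_mul_of_nonneg_left (hT2 l).le (hq l)
      simp only [mul_add, Finset.sum_add_distrib, ← Finset.sum_mul] at h5
      have h6 : ∑ n, M.minRatio V q n - D * (T : ℝ)⁻¹ ≤
          V * R.avgPenalty T + ∑ l, q l * R.avgMetric l T := by
        refine le_of_mul_le_mul_left (le_trans (le_of_eq ?_) h) hT0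
        field_simp
        rw [hD]
        ring
      simp only [hS, mul_add]
      linarith
    refine ge_of_tendsto ?_ h3
    simpa using ((tendsto_inv_atTop_nhds_zero_nat (𝕜 := ℝ)).const_mul D).const_add
      (V * x + ∑ l, q l * M.d l + η * S)
  -- The added 1 keeps the divisor positive when all weights vanish.
  refine le_of_forall_pos_le_add fun η hη => (key (η / (S + 1)) (by positivity)).trans ?_
  refine add_le_add le_rfl ?_
  rw [div_mul_eq_mul_div, div_le_iff₀ (by positivity)]
  nlinarith

end Run

lemma IsBounded.sum_minRatio_le (hb : M.IsBounded ymax zmax dmax B) (hf : M.Feasible) {V : ℝ}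
    (hV : 0 < V) {q : Fin L → ℝ} (hq : ∀ l, 0 ≤ q l) :
    ∑ n, M.minRatio V q n ≤ V * M.fStar + ∑ l, q l * M.d l := by
  have h : (∑ n, M.minRatio V q n - ∑ l, q l * M.d l) / V ≤ M.fStar := by
    refine le_csInf hf ?_
    rintro x ⟨Ω, _, P, _, R, hR, rfl⟩
    rw [div_le_iff₀ hV]
    have := R.sum_minRatio_le_limsup hb hR hV.le hq
    linarith
  rw [div_le_iff₀ hV] at h
  linarith

/-- Single actions give points of the performance region. Since the systems choose their actions
separately, near-minimizers can be taken in all of them at once, each within η / (N + 1). -/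
lemma IsLagrangeMultiplier.le_sum_minRatio {γ : Fin L → ℝ} (hγ : M.IsLagrangeMultiplier γ)
    [∀ n, Nonempty (M.A n)] :
    M.fStar + ∑ l, γ l * M.d l ≤ ∑ n, M.minRatio 1 γ n := by
  have hmem : ∀ n a, (M.fHat n a, M.gHat n a) ∈ M.perfRegion n := fun n a =>
    ⟨(M.yHat n a, M.zHat n a, M.THat n a), subset_convexHull ℝ _ ⟨a, rfl⟩, rfl⟩
  have h1 : ∀ a : ∀ n, M.A n, M.fStar + ∑ l, γ l * M.d l ≤ ∑ n, M.ratio 1 γ n (a n) := by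
    intro a
    refine (hγ.2 (fun n => (M.fHat n (a n), M.gHat n (a n))) fun n => hmem n (a n)).trans_eq ?_
    simp only [ratio, one_mul, Finset.sum_add_distrib, Finset.mul_sum]
    rw [Finset.sum_comm]
  refine le_of_forall_pos_le_add fun η hη => ?_
  have hη' : 0 < η / (N + 1) := by positivity
  choose a ha using fun n => exists_lt_of_ciInf_lt
    (show M.minRatio 1 γ n < M.minRatio 1 γ n + η / (N + 1) by linarith)
  refine (h1 a).trans ((Finset.sum_le_sum fun n _ => (ha n).le).trans ?_)
  rw [Finset.sum_add_distrib]
  refine add_le_add le_rfl ?_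
  rw [Finset.sum_const, Finset.card_univ, Fintype.card_fin, nsmul_eq_mul, ← mul_div_assoc,
    div_le_iff₀ (by positivity)]
  nlinarith

/-! ### Quadratic drift of the virtual queues -/

namespace Run

variable {Ω : Type v} [mΩ : MeasurableSpace Ω] {P : Measure Ω} (R : M.Run P)

lemma integral_ext (t : ℕ) (l : Fin L) : ∫ ω, R.ext t ω l ∂P = M.d l := by
  rw [d, ← R.ext_law t, integral_map (R.measurable_ext t).aemeasurable
    (measurable_pi_apply l).aestronglyMeasurable]

/-- Q[t] is a function of the slots before t, hence independent of d[t]. -/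
lemma integral_Q_mul_ext [IsProbabilityMeasure P] (t : ℕ) (l : Fin L) :
    ∫ ω, R.Q ω t l * R.ext t ω l ∂P = (∫ ω, R.Q ω t l ∂P) * M.d l := by
  have h1 : IndepFun (R.ext t) (fun ω => R.Q ω t) P :=
    (IndepFun_iff_Indep _ _ _).2
      (indep_of_indep_of_le_right (R.ext_indep t) (R.measurable_history_Q le_rfl).comap_le)
  have h2 : IndepFun (fun ω => R.Q ω t l) (fun ω => R.ext t ω l) P :=
    (h1.comp (measurable_pi_apply l) (measurable_pi_apply l)).symm
  rw [← R.integral_ext t l]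
  exact h2.integral_mul_eq_mul_integral (R.measurable_Q_apply t l).aestronglyMeasurable
    ((measurable_pi_apply l).comp (R.measurable_ext t)).aestronglyMeasurable

lemma integrable_ext [IsFiniteMeasure P] (hb : M.IsBounded ymax zmax dmax B) (t : ℕ) (l : Fin L) :
    Integrable (fun ω => R.ext t ω l) P := by
  refine Integrable.of_bound
    ((measurable_pi_apply l).comp (R.measurable_ext t)).aestronglyMeasurable |dmax| ?_
  filter_upwards [R.ae_abs_ext_le hb] with ω h
  exact h t l

lemma integrable_Q_mul_ext [IsFiniteMeasure P] (hb : M.IsBounded ymax zmax dmax B)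
    (t : ℕ) (l : Fin L) : Integrable (fun ω => R.Q ω t l * R.ext t ω l) P := by
  refine (R.integrable_ext hb t l).bdd_mul (c := queueStep N zmax dmax * t)
    (R.measurable_Q_apply t l).aestronglyMeasurable ?_
  filter_upwards [R.ae_Q_le hb t] with ω h
  exact h t le_rfl l

lemma integrable_Q_sq [IsFiniteMeasure P] (hb : M.IsBounded ymax zmax dmax B)
    (t : ℕ) (l : Fin L) : Integrable (fun ω => R.Q ω t l ^ 2) P := by
  simp_rw [sq]
  refine (R.integrable_Q hb t l).bdd_mul (c := queueStep N zmax dmax * t)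
    (R.measurable_Q_apply t l).aestronglyMeasurable ?_
  filter_upwards [R.ae_Q_le hb t] with ω h
  exact h t le_rfl l

/-- The quadratic drift of the virtual queues. -/
lemma integral_Q_sq_le [IsProbabilityMeasure P] (hb : M.IsBounded ymax zmax dmax B)
    (T : ℕ) (l : Fin L) :
    ∫ ω, R.Q ω T l ^ 2 ∂P ≤ 2 * ∑ t ∈ Finset.range T,
      (∑ n, ∫ ω, R.Q ω t l * R.z n t ω l ∂P - (∫ ω, R.Q ω t l ∂P) * M.d l) +
        T * queueStep N zmax dmax ^ 2 := by
  induction T with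
  | zero => simp [Q]
  | succ t ih =>
    have hQz : Integrable (fun ω => ∑ n, R.Q ω t l * R.z n t ω l) P :=
      integrable_finsetSum _ fun n _ => R.integrable_Q_mul_z hb n t l
    have hi : Integrable (fun ω => 2 * (∑ n, R.Q ω t l * R.z n t ω l - R.Q ω t l * R.ext t ω l)) P :=
      (hQz.sub (R.integrable_Q_mul_ext hb t l)).const_mul 2
    have hi2 : Integrable (fun ω => R.Q ω t l ^ 2 +
        2 * (∑ n, R.Q ω t l * R.z n t ω l - R.Q ω t l * R.ext t ω l)) P :=
      (R.integrable_Q_sq hb t l).add hi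
    have h : ∫ ω, R.Q ω (t + 1) l ^ 2 ∂P ≤ ∫ ω, (R.Q ω t l ^ 2 +
        2 * (∑ n, R.Q ω t l * R.z n t ω l - R.Q ω t l * R.ext t ω l) +
          queueStep N zmax dmax ^ 2) ∂P := by
      refine integral_mono_ae (R.integrable_Q_sq hb (t + 1) l) (hi2.add (integrable_const _)) ?_
      filter_upwards [R.ae_abs_increment_le hb] with ω h
      have hu := sq_le_sq' (neg_le_of_abs_le (h t l)) (le_of_abs_le (h t l))
      rw [← Finset.mul_sum, ← mul_sub, Q_succ]
      set x := R.Q ω t l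
      set w := ∑ n, R.z n t ω l - R.ext t ω l with hw
      rw [show x + ∑ n, R.z n t ω l - R.ext t ω l = x + w by rw [hw]; ring]
      have hmax : max (x + w) 0 ^ 2 ≤ (x + w) ^ 2 := by
        rcases max_cases (x + w) 0 with ⟨h1, _⟩ | ⟨h1, _⟩ <;> rw [h1]
        rw [zero_pow two_ne_zero]
        exact sq_nonneg _
      linarith [add_sq x w]
    rw [integral_add hi2 (integrable_const _), integral_add (R.integrable_Q_sq hb t l) hi,
      integral_const_mul, integral_sub hQz (R.integrable_Q_mul_ext hb t l),
      integral_finsetSum _ fun n _ => R.integrable_Q_mul_z hb n t l, R.integral_Q_mul_ext,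
      integral_const, probReal_univ, one_smul] at h
    rw [Finset.sum_range_succ]
    push_cast
    linarith

/-- Nonnegativity of the variance, from E (Q - c)² ≥ 0 with c = E Q. -/
lemma sq_integral_Q_le [IsProbabilityMeasure P] (hb : M.IsBounded ymax zmax dmax B)
    (T : ℕ) (l : Fin L) : (∫ ω, R.Q ω T l ∂P) ^ 2 ≤ ∫ ω, R.Q ω T l ^ 2 ∂P := by
  set c := ∫ ω, R.Q ω T l ∂P with hc
  have h : ∫ ω, (2 * c * R.Q ω T l - c ^ 2) ∂P ≤ ∫ ω, R.Q ω T l ^ 2 ∂P :=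
    integral_mono (((R.integrable_Q hb T l).const_mul _).sub (integrable_const _))
      (R.integrable_Q_sq hb T l) fun ω => by
        dsimp only
        linarith [sub_sq (R.Q ω T l) c, sq_nonneg (R.Q ω T l - c)]
  rw [integral_sub ((R.integrable_Q hb T l).const_mul _) (integrable_const _), integral_const_mul,
    integral_const, probReal_univ, one_smul, ← hc] at h
  linarith

/-- Telescoping of Q[t+1] ≥ Q[t] + ∑ z[t] - d[t] from Q[0] = 0: the queue dominates the accumulated
violation. -/
lemma mul_avgMetric_le [IsProbabilityMeasure P] (hb : M.IsBounded ymax zmax dmax B)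
    (T : ℕ) (l : Fin L) : T * R.avgMetric l T ≤ T * M.d l + ∫ ω, R.Q ω T l ∂P := by
  rw [mul_avgMetric]
  induction T with
  | zero => simp [Q]
  | succ t ih =>
    have hz : Integrable (fun ω => ∑ n, R.z n t ω l) P :=
      integrable_finsetSum _ fun n _ => R.integrable_z hb n t l
    have hQz : Integrable (fun ω => R.Q ω t l + ∑ n, R.z n t ω l) P :=
      (R.integrable_Q hb t l).add hz
    have h : ∫ ω, (R.Q ω t l + ∑ n, R.z n t ω l - R.ext t ω l) ∂P ≤ ∫ ω, R.Q ω (t + 1) l ∂P :=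
      integral_mono (hQz.sub (R.integrable_ext hb t l)) (R.integrable_Q hb (t + 1) l)
        fun ω => le_max_left _ _
    rw [integral_sub hQz (R.integrable_ext hb t l), integral_add (R.integrable_Q hb t l) hz,
      integral_finsetSum _ fun n _ => R.integrable_z hb n t l, integral_ext] at h
    simp_rw [Finset.sum_range_succ, Finset.sum_add_distrib]
    push_cast
    linarith

/-- The drift-plus-penalty inequality for the algorithm. -/
theorem FollowsAlgorithm.drift_plus_penalty_le [IsProbabilityMeasure P] {R : M.Run P} {V : ℝ}
    (hR : R.FollowsAlgorithm V) (hb : M.IsBounded ymax zmax dmax B) (hf : M.Feasible) (hV : 0 < V)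
    (T : ℕ) :
    (∑ l, ∫ ω, R.Q ω T l ^ 2 ∂P) / 2 + V * (T * R.avgPenalty T) ≤ V * (T * M.fStar) +
      (N * (B * scoreBound L ymax zmax V (queueStep N zmax dmax * T) +
        2 * |zmax| * L * queueStep N zmax dmax * (B * T)) +
          L * (T * queueStep N zmax dmax ^ 2) / 2) := by
  have h1 := Finset.sum_le_sum fun n (_ : n ∈ Finset.univ) => hR.integral_sum_sub_minRatio_le hb n T
  have h2 := Finset.sum_le_sum fun l (_ : l ∈ Finset.univ) => R.integral_Q_sq_le hb T l
  -- The comparison with `fStar` holds for every deterministic q ≥ 0, so it can be applied pointwise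
  -- at the random vector Q[t] and integrated.
  have h3 : ∀ t, ∑ n, ∫ ω, M.minRatio V (R.Q ω t) n ∂P ≤
      V * M.fStar + ∑ l, (∫ ω, R.Q ω t l ∂P) * M.d l := by
    intro t
    have hi : Integrable (fun ω => ∑ l, R.Q ω t l * M.d l) P :=
      integrable_finsetSum _ fun l _ => (R.integrable_Q hb t l).mul_const _
    rw [← integral_finsetSum _ fun n _ => R.integrable_minRatio_Q hb V n t]
    refine (integral_mono (integrable_finsetSum _ fun n _ => R.integrable_minRatio_Q hb V n t)
      ((integrable_const (V * M.fStar)).add hi)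
      fun ω => hb.sum_minRatio_le hf hV (R.Q_nonneg ω t)).trans_eq ?_
    simp only [Pi.add_apply]
    rw [integral_add (integrable_const _) hi, integral_const, probReal_univ, one_smul,
      integral_finsetSum _ fun l _ => (R.integrable_Q hb t l).mul_const _]
    simp_rw [integral_mul_const]
  have h4 := Finset.sum_le_sum fun t (_ : t ∈ Finset.range T) => h3 t
  have h5 := R.mul_avgPenalty T
  simp only [Finset.sum_sub_distrib, Finset.sum_add_distrib, ← Finset.mul_sum, Finset.sum_const,
    Finset.card_univ, Fintype.card_fin, Finset.card_range, nsmul_eq_mul] at h1 h2 h4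
  rw [← h5] at h1
  have e1 : ∑ n, ∑ t ∈ Finset.range T, ∑ l, ∫ ω, R.Q ω t l * R.z n t ω l ∂P =
      ∑ l, ∑ t ∈ Finset.range T, ∑ n, ∫ ω, R.Q ω t l * R.z n t ω l ∂P := by
    rw [Finset.sum_comm]
    simp_rw [Finset.sum_comm (s := (Finset.univ : Finset (Fin N)))]
    rw [Finset.sum_comm]
  have e2 : ∑ n, ∑ t ∈ Finset.range T, ∫ ω, M.minRatio V (R.Q ω t) n ∂P =
      ∑ t ∈ Finset.range T, ∑ n, ∫ ω, M.minRatio V (R.Q ω t) n ∂P := Finset.sum_comm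
  have e3 : ∑ l, ∑ t ∈ Finset.range T, (∫ ω, R.Q ω t l ∂P) * M.d l =
      ∑ t ∈ Finset.range T, ∑ l, (∫ ω, R.Q ω t l ∂P) * M.d l := Finset.sum_comm
  rw [e1, e2] at h1
  rw [e3] at h2
  linarith

end Run

end RenewalModel

end

/-! ### From the drift inequality to the convergence time -/

/-- The numerical estimate behind the convergence time: `X` is the cumulative penalty, `w` the
expected virtual queues at time `T`. -/
lemma drift_bounds {L : ℕ} {w γ : Fin L → ℝ} {V T X F k₁ k₂ k₃ : ℝ} (hV : 1 ≤ V) (hVT : V ^ 2 ≤ T)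
    (hk₁ : 0 ≤ k₁) (hk₂ : 0 ≤ k₂) (hk₃ : 0 ≤ k₃)
    (h₁ : (∑ l, w l ^ 2) / 2 + V * X ≤ V * (T * F) + (T * k₁ + V * k₂))
    (h₂ : T * F - ∑ l, γ l * w l - k₃ ≤ X) :
    X - T * F ≤ T * (V⁻¹ * (k₁ + k₂)) ∧
      ∀ l, w l ≤ T * (V⁻¹ * √(4 * (k₁ + k₂ + k₃ + ∑ l, γ l ^ 2))) := by
  have hV0 : 0 < V := by linarith
  have hVT' : V ≤ T := (by nlinarith : V ≤ V ^ 2).trans hVT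
  have hT0 : 0 < T := by linarith
  have hsq : 0 ≤ ∑ l, w l ^ 2 := Finset.sum_nonneg fun _ _ => sq_nonneg _
  set G := ∑ l, γ l ^ 2 with hG
  have hG0 : 0 ≤ G := Finset.sum_nonneg fun _ _ => sq_nonneg _
  constructor
  · have h : V * (X - T * F) ≤ V * (T * (V⁻¹ * (k₁ + k₂))) := by
      have e : V * (T * (V⁻¹ * (k₁ + k₂))) = T * k₁ + T * k₂ := by field_simp
      rw [e]
      nlinarith
    exact le_of_mul_le_mul_left h hV0
  · intro l
    have h3 : V * (T * F - ∑ l, γ l * w l - k₃) ≤ V * X := mul_le_mul_of_nonneg_left h₂ hV0.le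
    -- Completing the square absorbs the possible gain V⟨γ, w⟩ in penalty into half of the quadratic
    -- term, leaving V² ∑ γ_l², which is O(T).
    have h4 : ∑ l, (w l ^ 2 / 4 - V ^ 2 * γ l ^ 2) ≤ ∑ l, (w l ^ 2 / 2 - V * (γ l * w l)) :=
      Finset.sum_le_sum fun l _ => by nlinarith [sq_nonneg (w l / 2 - V * γ l)]
    simp only [Finset.sum_sub_distrib, ← Finset.mul_sum, ← Finset.sum_div, ← hG] at h4
    have h5 : V ^ 2 * G ≤ T * G := mul_le_mul_of_nonneg_right hVT hG0
    have h6 : V * k₂ ≤ T * k₂ := mul_le_mul_of_nonneg_right hVT' hk₂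
    have h7 : V * k₃ ≤ T * k₃ := mul_le_mul_of_nonneg_right hVT' hk₃
    have h8 : ∑ l, w l ^ 2 ≤ T * (4 * (k₁ + k₂ + k₃ + G)) := by linarith
    have h9 : w l ^ 2 ≤ ∑ l, w l ^ 2 :=
      Finset.single_le_sum (fun l _ => sq_nonneg (w l)) (Finset.mem_univ l)
    have hk : 0 ≤ 4 * (k₁ + k₂ + k₃ + G) := by positivity
    -- After squaring, the claim reduces to T ≤ (T / V)², that is V² ≤ T: this is the requirement T
    -- ≥ 1/ε².
    refine le_of_abs_le (abs_le_of_sq_le_sq ?_ (by positivity))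
    rw [mul_pow, mul_pow, Real.sq_sqrt hk]
    refine (h9.trans h8).trans ?_
    rw [← mul_assoc (T ^ 2)]
    refine mul_le_mul_of_nonneg_right ?_ hk
    rw [inv_pow, ← div_eq_mul_inv, le_div_iff₀ (by positivity), sq T]
    exact mul_le_mul_of_nonneg_left hVT hT0.le

theorem mainTheorem2 (N L : ℕ) (ymax zmax dmax B : ℝ) (γ : Fin L → ℝ) :
    ∃ C : ℝ, ∀ M : RenewalModel.{u} N L,
      M.IsBounded ymax zmax dmax B → M.IsCompactPerformance → M.Feasible →
      M.IsLagrangeMultiplier γ →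
      ∀ ε : ℝ, 0 < ε → ε < 1 →
      ∀ (Ω : Type v) [MeasurableSpace Ω] (P : Measure Ω) [IsProbabilityMeasure P] (R : M.Run P),
        R.FollowsAlgorithm (1 / ε) →
        ∀ T : ℕ, 1 / ε ^ 2 ≤ (T : ℝ) →
          R.avgPenalty T ≤ M.fStar + C * ε ∧
          ∀ l, R.avgMetric l T ≤ M.d l + C * ε := by
  set δ := RenewalModel.Run.queueStep N zmax dmax with hδ
  have hδ0 : 0 ≤ δ := RenewalModel.Run.queueStep_nonneg
  -- k₁ collects the terms linear in T: 2|zmax|Lδ from outdated queues, as much from the frame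
  -- straddling T (queues up to δT enter its score bound), and δ²/2 per queue from the drift. k₂
  -- collects the terms linear in V; k₃ is the boundary term under the weights (1, γ).
  set k₁ := N * B * (4 * |zmax| * L * δ) + L * δ ^ 2 / 2 with hk₁
  set k₂ := N * B * (2 * |ymax|) with hk₂
  set k₃ := N * (B * RenewalModel.Run.scoreBound L ymax zmax 1 ‖γ‖) with hk₃
  set K := √(4 * (k₁ + k₂ + k₃ + ∑ l, γ l ^ 2)) with hK
  refine ⟨k₁ + k₂ + K, ?_⟩
  intro M hb _ hf hγ ε hε hε1 Ω _ P _ R hR T hT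
  have hB : 0 ≤ B := zero_le_one.trans hb.one_le
  have hk₁0 : 0 ≤ k₁ := by positivity
  have hk₂0 : 0 ≤ k₂ := by positivity
  have hk₃0 : 0 ≤ k₃ := by
    have := RenewalModel.Run.scoreBound_nonneg (L := L) (ymax := ymax) (zmax := zmax) (v := 1) (norm_nonneg γ)
    positivity
  have hK0 : 0 ≤ K := Real.sqrt_nonneg _
  have hV : 1 ≤ 1 / ε := (one_le_div hε).2 hε1.le
  have hVT : (1 / ε) ^ 2 ≤ (T : ℝ) := by rwa [one_div_pow]
  have hT0 : (0 : ℝ) < T := lt_of_lt_of_le (by positivity) hT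
  have : ∀ n, Nonempty (M.A n) := R.nonempty_act
  have hmetric := R.mul_avgMetric_le hb T
  have hdrift := hR.drift_plus_penalty_le hb hf (by positivity) T
  have hlow := R.le_mul_avg hb 1 (norm_nonneg γ) (fun l => norm_le_pi_norm γ l) T
  have h₁ : (∑ l, (∫ ω, R.Q ω T l ∂P) ^ 2) / 2 + 1 / ε * (T * R.avgPenalty T) ≤
      1 / ε * (T * M.fStar) + (T * k₁ + 1 / ε * k₂) := by
    have hj := Finset.sum_le_sum fun l (_ : l ∈ Finset.univ) => R.sq_integral_Q_le hb T l
    refine le_trans (by linarith) (hdrift.trans_eq ?_)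
    rw [RenewalModel.Run.scoreBound, abs_of_pos (show 0 < 1 / ε by positivity), hk₁, hk₂]
    ring
  -- The penalty can fall below T f_* only by violating constraints, at price γ_l per unit, and the
  -- total violation is at most E Q_l[T].
  have h₂ : T * M.fStar - ∑ l, γ l * ∫ ω, R.Q ω T l ∂P - k₃ ≤ T * R.avgPenalty T := by
    have h3 := mul_le_mul_of_nonneg_left hγ.le_sum_minRatio hT0.le
    have h4 := Finset.sum_le_sum fun l (_ : l ∈ Finset.univ) =>
      mul_le_mul_of_nonneg_left (hmetric l) (hγ.1 l)
    have e1 : ∑ l, γ l * (T * R.avgMetric l T) = T * ∑ l, γ l * R.avgMetric l T := by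
      rw [Finset.mul_sum]
      exact Finset.sum_congr rfl fun l _ => by ring
    have e2 : ∑ l, γ l * (T * M.d l + ∫ ω, R.Q ω T l ∂P) =
        T * ∑ l, γ l * M.d l + ∑ l, γ l * ∫ ω, R.Q ω T l ∂P := by
      rw [Finset.mul_sum, ← Finset.sum_add_distrib]
      exact Finset.sum_congr rfl fun l _ => by ring
    rw [e1, e2] at h4
    linarith
  obtain ⟨hX, hw⟩ := drift_bounds hV hVT hk₁0 hk₂0 hk₃0 h₁ h₂
  rw [one_div, inv_inv] at hX hw
  constructor
  · refine le_of_mul_le_mul_left (?_ : (T : ℝ) * _ ≤ T * _) hT0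
    nlinarith [mul_nonneg hT0.le (mul_nonneg hε.le hK0)]
  · intro l
    refine le_of_mul_le_mul_left (?_ : (T : ℝ) * _ ≤ T * _) hT0
    have h5 := hmetric l
    have h6 := hw l
    rw [← hK] at h6
    nlinarith [mul_nonneg hT0.le (mul_nonneg hε.le (add_nonneg hk₁0 hk₂0))]
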